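/- Let $L$ be a number field with no real embeddings and let $\mathbb V_L$ be its set of places (finite and infinite). For a $p$-adic field $E$ with residue field $k$, and an algebraically closed perfectoid field $F\supseteq k$ of characteristic $p$ with valuation ring $\mathcal O_F$, let $A=W_{\mathcal O_E}(\mathcal O_F)=\mathcal O_E\otimes_{W(k)}W(\mathcal O_F)$. An element of $A$ is primitive of degree one if it has the form $[a]+\varpi u$ with $a\in\mathcal O_F$, $0<|a|<1$, $\varpi$ a uniformizer of $E$ and $u\in A^\times$. The set $|\mathscr Y_{F,E}|$ of closed classical points of the Fargues–Fontaine curve $\mathscr Y_{F,E}$ is the set of ideals $\mathfrak m_y=(\xi)$ of $A$ generated by primitive elements $\xi$ of degree one. For $f\in A$ let $|f(y)|=\inf\{|z| : z\in\mathcal O_F,\ f\in [z]A+\mathfrak m_y\}$; this is the absolute value of the image of $f$ in the residue field $K_y$ at $y$, normalised by $|[z](y)|=|z|$. Give $|\mathscr Y_{F,E}|$ the topology defined by $d(y_1,y_2)=|\xi_1(y_2)|$, where $\mathfrak m_{y_1}=(\xi_1)$: a set $U$ is open if and only if for each $y\in U$ there is $\varepsilon>0$ such that all $z$ with $d(y,z)<\varepsilon$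 lie in $U$. For a finite place $v$ of $L$ let $L_v$ be the completion of $L$ at $v$, $C_v$ the completion of an algebraic closure of $L_v$, and $C_v^\flat$ its tilt. The space of arithmeticoids of $L$ is the product, with the product topology, $$\mathbf Y_L=\prod_{v\nmid\infty}|\mathscr Y_{C_v^\flat,L_v}|\times\prod_{v\mid\infty}\mathbb R_{>0}.$$ Then: 1. The set $\mathbb V_L$ is countable, and every factor of $\mathbf Y_L$ is metrisable. More precisely, at a finite place $v$ the function $d_v=d$ is a metric on $|\mathscr Y_{C_v^\flat,L_v}|$ which induces its topology. 2. The space $\mathbf Y_L$ is metrisable. More precisely, for every injective map $e:\mathbb V_L\to\mathbb N$ the standard distance $$D_e(\mathbf y,\mathbf z)=\sum_{v\in\mathbb V_L}\min\bigl(2^{-e(v)},\,d_v(y_v,z_v)\bigr),$$ where $d_v(r,s)=|r-s|$ at the infinite places, is a metric on the set of arithmeticoids of $L$ which induces the topology of $\mathbf Y_L$. This gives a distance between any two arithmeticoids. 3. For every family $(F_v)_{v\nmid\infty}$ of algebraically closed, complete, non-trivially valued non-archimedean fields $F_v$ of characteristic equal to the residue characteristic of $v$, with embeddings of the residue field of $L_v$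 into $\mathcal O_{F_v}$, the space $\prod_{v\nmid\infty}|\mathscr Y_{F_v,L_v}|\times\prod_{v\mid\infty}\mathbb R_{>0}$ is metrisable. This includes the variants $\mathbf Y_L^{max}$ ($F_v$ the tilt of a maximally complete immediate extension of $C_v$) and $\mathbf Y_L^{\mathbb R}$ ($F_v=\overline{\mathbb F}_{p_v}((t^{\mathbb R}))$). -/

import Mathlib

open IsDedekindDomain NumberField
open scoped NNReal

universe u w

namespace FarguesFontaine

/-! ### Valuation rings of complete non-archimedean fields -/

/-- The valuation ring `𝒪_K = {x | ‖x‖ ≤ 1}` of a non-archimedean normed field `K`. -/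
noncomputable abbrev integers (K : Type u) [NormedField K] [IsUltrametricDist K] : Subring K :=
  (NormedField.valuation (K := K)).integer

theorem mem_integers {K : Type u} [NormedField K] [IsUltrametricDist K] {x : K} :
    x ∈ integers K ↔ ‖x‖ ≤ 1 := Iff.rfl

instance not_isUnit_natCast (K : Type u) [NormedField K] [IsUltrametricDist K] (p : ℕ)
    [hp : Fact (‖(p : K)‖ < 1)] : Fact (¬ IsUnit (p : integers K)) := by
  refine ⟨fun h => ?_⟩
  have h1 := (Valuation.integer.integers (NormedField.valuation (K := K))).one_of_isUnit h
  have h2 : ‖(p : K)‖ = 1 := by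
    simpa using congrArg NNReal.toReal h1
  exact absurd h2 hp.out.ne

theorem mem_span_natCast_pow_iff {K : Type u} [NormedField K] [IsUltrametricDist K] {p : ℕ}
    (hp0 : (p : K) ≠ 0) (n : ℕ) (x : integers K) :
    x ∈ Ideal.span {(p : integers K)} ^ n ↔ ‖(x : K)‖ ≤ ‖(p : K)‖ ^ n := by
  rw [Ideal.span_singleton_pow, Ideal.mem_span_singleton]
  constructor
  · rintro ⟨y, rfl⟩
    have hy : ‖(y : K)‖ ≤ 1 := y.2
    simp only [Subring.coe_mul, norm_mul, Subring.coe_pow, Subring.coe_natCast, norm_pow]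
    exact mul_le_of_le_one_right (by positivity) hy
  · intro hx
    have hpn : (p : K) ^ n ≠ 0 := pow_ne_zero _ hp0
    refine ⟨⟨(x : K) / (p : K) ^ n, ?_⟩, ?_⟩
    · rw [mem_integers, norm_div, norm_pow]
      exact div_le_one_of_le₀ hx (by positivity)
    · ext
      simp only [Subring.coe_mul, Subring.coe_pow, Subring.coe_natCast]
      field_simp

/-- The valuation ring of a complete non-archimedean field in which `|p| < 1` is `p`-adically
complete. -/
instance isAdicComplete_integers (K : Type u) [NormedField K] [IsUltrametricDist K]
    [CompleteSpace K] (p : ℕ) [hp : Fact (‖(p : K)‖ < 1)] :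
    IsAdicComplete (Ideal.span {(p : integers K)}) (integers K) := by
  by_cases hp0 : (p : K) = 0
  · have h0 : (p : integers K) = 0 := by
      ext
      simpa using hp0
    rw [h0, Ideal.span_singleton_zero]
    infer_instance
  have hppos : 0 < ‖(p : K)‖ := norm_pos_iff.2 hp0
  have hlim : Filter.Tendsto (fun n : ℕ => ‖(p : K)‖ ^ n) Filter.atTop (nhds 0) :=
    tendsto_pow_atTop_nhds_zero_of_lt_one (norm_nonneg _) hp.out
  refine { haus' := ?_, prec' := ?_ }
  · intro x hx
    have hx' : ∀ n : ℕ, ‖(x : K)‖ ≤ ‖(p : K)‖ ^ n := by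
      intro n
      have := hx n
      rw [SModEq.zero, smul_eq_mul, Ideal.mul_top, mem_span_natCast_pow_iff hp0] at this
      exact this
    have : ‖(x : K)‖ ≤ 0 := ge_of_tendsto' hlim hx'
    ext
    simpa using this
  · intro f hf
    have hf' : ∀ m n : ℕ, m ≤ n → ‖(f m : K) - (f n : K)‖ ≤ ‖(p : K)‖ ^ m := by
      intro m n hmn
      have := hf hmn
      rw [SModEq.sub_mem, smul_eq_mul, Ideal.mul_top, mem_span_natCast_pow_iff hp0] at this
      exact this
    have hc : CauchySeq (fun n => (f n : K)) := by
      refine cauchySeq_of_le_tendsto_0' (fun n => ‖(p : K)‖ ^ n) ?_ hlim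
      intro n m hnm
      rw [dist_eq_norm]
      exact hf' n m hnm
    obtain ⟨l, hl⟩ := cauchySeq_tendsto_of_complete hc
    have hl1 : ‖l‖ ≤ 1 := le_of_tendsto' hl.norm (fun n => (f n).2)
    refine ⟨⟨l, hl1⟩, fun n => ?_⟩
    rw [SModEq.sub_mem, smul_eq_mul, Ideal.mul_top, mem_span_natCast_pow_iff hp0]
    have h1 : Filter.Tendsto (fun m => ‖(f n : K) - (f m : K)‖) Filter.atTop
        (nhds ‖(f n : K) - l‖) := (tendsto_const_nhds.sub hl).norm
    exact le_of_tendsto h1 (Filter.eventually_atTop.2 ⟨n, fun m hm => hf' n m hm⟩)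

/-! ### The ring `W_{𝒪_E}(𝒪_F)`

`E` is a complete non-archimedean field with `|p| < 1` (in the application: a finite extension of
`ℚ_p`) with residue field `k`.  The perfection `PreTilt 𝒪_E p` of `𝒪_E / p` is canonically the
residue field `k`, and Fontaine's map `W(PreTilt 𝒪_E p) → 𝒪_E` is the canonical map
`W(k) → 𝒪_E`. -/

section Witt

variable (E : Type u) [NormedField E] [IsUltrametricDist E] [CompleteSpace E]
  (p : ℕ) [Fact p.Prime] [Fact (‖(p : E)‖ < 1)]
  {O : Type w} [CommRing O] (i : PreTilt (integers E) p →+* O)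

/-- Fontaine's map makes `𝒪_E` an algebra over `W(k)`. -/
@[reducible] noncomputable def baseAlgebra :
    Algebra (WittVector p (PreTilt (integers E) p)) (integers E) :=
  (WittVector.fontaineTheta (integers E) p).toAlgebra

/-- The structure map `i : k → O` makes `W(O)` an algebra over `W(k)`. -/
@[reducible] noncomputable def wittAlgebra :
    Algebra (WittVector p (PreTilt (integers E) p)) (WittVector p O) :=
  (WittVector.map i).toAlgebra

/-- The ring `W_{𝒪_E}(O) = 𝒪_E ⊗_{W(k)} W(O)` of ramified Witt vectors of a (perfect)
`k`-algebra `O`, with structure map `i : k → O`. -/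
def RamifiedWitt : Type (max u w) :=
  @TensorProduct (WittVector p (PreTilt (integers E) p)) _ (integers E) (WittVector p O) _ _
    (baseAlgebra E p).toModule (wittAlgebra E p i).toModule

namespace RamifiedWitt

noncomputable instance : CommRing (RamifiedWitt E p i) :=
  @Algebra.TensorProduct.instCommRing (WittVector p (PreTilt (integers E) p)) (integers E)
    (WittVector p O) _ _ (baseAlgebra E p) _ (wittAlgebra E p i)

/-- The structure map `𝒪_E → W_{𝒪_E}(O)`, `x ↦ x ⊗ 1`. -/
noncomputable def ofBase : integers E →+* RamifiedWitt E p i :=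
  @Algebra.TensorProduct.includeLeftRingHom (WittVector p (PreTilt (integers E) p)) (integers E)
    (WittVector p O) _ _ (baseAlgebra E p) _ (wittAlgebra E p i)

/-- The canonical map `W(O) → W_{𝒪_E}(O)`, `x ↦ 1 ⊗ x`. -/
noncomputable def ofWitt : WittVector p O →+* RamifiedWitt E p i :=
  letI := baseAlgebra E p
  letI := wittAlgebra E p i
  RingHomClass.toRingHom (Algebra.TensorProduct.includeRight :
    WittVector p O →ₐ[WittVector p (PreTilt (integers E) p)]
      TensorProduct (WittVector p (PreTilt (integers E) p)) (integers E) (WittVector p O))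

/-- The Teichmüller representative `[a] ∈ W_{𝒪_E}(O)` of `a ∈ O`. -/
noncomputable def teich (a : O) : RamifiedWitt E p i :=
  ofWitt E p i (WittVector.teichmuller p a)

end RamifiedWitt

/-! ### The classical points of the curve and their metric

From here on `O` is the valuation ring `𝒪_F` of a perfectoid field `F ⊇ k` of characteristic `p`,
and `val` is its absolute value. -/

variable (val : Valuation O ℝ≥0)

/-- `ξ = ∑ [xₙ] ϖⁿ` is primitive of degree one if `x₀ ≠ 0`, `|x₀| < 1` and `x₁` is a unit of `𝒪_F`,
that is, `ξ = [a] + ϖ u` with `0 < |a| < 1`, `ϖ` a uniformiser of `E` and `u` a unit. -/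
def IsPrimitiveDegreeOne (ξ : RamifiedWitt E p i) : Prop :=
  ∃ (ϖ : integers E) (a : O) (u : (RamifiedWitt E p i)ˣ),
    Irreducible ϖ ∧ a ≠ 0 ∧ val a < 1 ∧
      ξ = RamifiedWitt.teich E p i a + RamifiedWitt.ofBase E p i ϖ * (u : RamifiedWitt E p i)

/-- The set `|𝒴_{F,E}|` of closed classical points of the curve, for `F` algebraically closed:
primitive elements of degree one modulo units, that is, the ideals `𝔪_y = (ξ)` generated by a
primitive element of degree one. -/
def ClassicalPoint : Type (max u w) :=
  {I : Ideal (RamifiedWitt E p i) //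
    ∃ ξ : RamifiedWitt E p i, IsPrimitiveDegreeOne E p i val ξ ∧ I = Ideal.span {ξ}}

namespace ClassicalPoint

variable {E p i val}

/-- The ideal `𝔪_y` of a classical point `y`. -/
def ideal (y : ClassicalPoint E p i val) : Ideal (RamifiedWitt E p i) := y.1

/-- A primitive element of degree one with divisor `y`, unique up to units. -/
noncomputable def generator (y : ClassicalPoint E p i val) : RamifiedWitt E p i :=
  y.2.choose

/-- The absolute value `|f(y)|` of `f ∈ W_{𝒪_E}(𝒪_F)` at a classical point `y`.  The quotient by
`𝔪_y` is the valuation ring `𝒪_{K_y}` of the untilt `K_y`, normalised by `|[z](y)| = |z|`, so that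
`|f(y)| ≤ |z|` exactly when `f(y) ∈ [z](y) 𝒪_{K_y}`, that is, when `f ∈ ([z]) + 𝔪_y`. -/
noncomputable def absAt (y : ClassicalPoint E p i val) (f : RamifiedWitt E p i) : ℝ :=
  sInf {r : ℝ | ∃ z : O, f ∈ Ideal.span {RamifiedWitt.teich E p i z} ⊔ y.ideal ∧ r = (val z : ℝ)}

/-- The Fargues–Fontaine distance `d(y₁, y₂) = |ξ₁(y₂)|`, where `𝔪_{y₁} = (ξ₁)`. -/
noncomputable def distance (y₁ y₂ : ClassicalPoint E p i val) : ℝ :=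
  y₂.absAt y₁.generator

/-- The topology of `|𝒴_{F,E}|`: the one given by the distance. -/
instance : TopologicalSpace (ClassicalPoint E p i val) where
  IsOpen U := ∀ y ∈ U, ∃ ε > (0 : ℝ), ∀ z, distance y z < ε → z ∈ U
  isOpen_univ := fun _ _ => ⟨1, one_pos, fun _ _ => trivial⟩
  isOpen_inter := by
    rintro U V hU hV y ⟨hyU, hyV⟩
    obtain ⟨ε, hε, h⟩ := hU y hyU
    obtain ⟨δ, hδ, h'⟩ := hV y hyV
    exact ⟨min ε δ, lt_min hε hδ, fun z hz =>
      ⟨h z (hz.trans_le (min_le_left _ _)), h' z (hz.trans_le (min_le_right _ _))⟩⟩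
  isOpen_sUnion := by
    rintro S hS y ⟨U, hUS, hyU⟩
    obtain ⟨ε, hε, h⟩ := hS U hUS y hyU
    exact ⟨ε, hε, fun z hz => ⟨U, hUS, h z hz⟩⟩

end ClassicalPoint

end Witt

/-- The absolute value of a non-archimedean field `F`, restricted to `𝒪_F`. -/
noncomputable def integersVal (F : Type w) [NormedField F] [IsUltrametricDist F] :
    Valuation (integers F) ℝ≥0 :=
  (NormedField.valuation (K := F)).comap (integers F).subtype

/-- The space `|𝒴_{F,E}|` for a field `F` of characteristic `p`, with `𝒪_F` a `k`-algebra by `i`. -/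
abbrev Curve (E : Type u) [NormedField E] [IsUltrametricDist E] [CompleteSpace E]
    (p : ℕ) [Fact p.Prime] [Fact (‖(p : E)‖ < 1)]
    (F : Type w) [NormedField F] [IsUltrametricDist F]
    (i : PreTilt (integers E) p →+* integers F) : Type (max u w) :=
  ClassicalPoint E p i (integersVal F)

/-! ### The completed algebraic closure of `E` and its tilt -/

section Closure

variable (E : Type u) [NontriviallyNormedField E] [IsUltrametricDist E] [CompleteSpace E]

/-- An algebraic closure of `E`, with the unique extension of the norm of `E`. -/
def AlgCl : Type u := AlgebraicClosure E

noncomputable instance : Field (AlgCl E) := inferInstanceAs (Field (AlgebraicClosure E))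

noncomputable instance : Algebra E (AlgCl E) := inferInstanceAs (Algebra E (AlgebraicClosure E))

instance : Algebra.IsAlgebraic E (AlgCl E) :=
  inferInstanceAs (Algebra.IsAlgebraic E (AlgebraicClosure E))

instance : IsAlgClosed (AlgCl E) := inferInstanceAs (IsAlgClosed (AlgebraicClosure E))

noncomputable instance : NormedField (AlgCl E) := spectralNorm.normedField E (AlgCl E)

instance : IsUltrametricDist (AlgCl E) :=
  IsUltrametricDist.isUltrametricDist_of_forall_norm_add_le_max_norm
    (isNonarchimedean_spectralNorm (K := E) (L := AlgCl E))

theorem AlgCl.norm_algebraMap (x : E) : ‖algebraMap E (AlgCl E) x‖ = ‖x‖ :=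
  spectralNorm_extends x

/-- The completion of the algebraic closure of `E`. -/
abbrev CompletedAlgCl : Type u := UniformSpace.Completion (AlgCl E)

instance : IsUltrametricDist (CompletedAlgCl E) := by
  refine IsUltrametricDist.isUltrametricDist_of_forall_norm_add_le_max_norm fun x y => ?_
  induction x, y using UniformSpace.Completion.induction_on₂ with
  | hp => exact isClosed_le (by fun_prop) (by fun_prop)
  | ih a b =>
    rw [← UniformSpace.Completion.coe_add]
    simp only [UniformSpace.Completion.norm_coe]
    exact IsUltrametricDist.norm_add_le_max a b

/-- The isometric embedding of `E` into its completed algebraic closure. -/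
noncomputable def embed : E →+* CompletedAlgCl E :=
  UniformSpace.Completion.coeRingHom.comp (algebraMap E (AlgCl E))

theorem norm_embed (x : E) : ‖embed E x‖ = ‖x‖ := by
  change ‖((algebraMap E (AlgCl E) x : AlgCl E) : CompletedAlgCl E)‖ = ‖x‖
  rw [UniformSpace.Completion.norm_coe, AlgCl.norm_algebraMap]

/-- The embedding of valuation rings. -/
noncomputable def embedIntegers : integers E →+* integers (CompletedAlgCl E) :=
  ((embed E).comp (integers E).subtype).codRestrict (integers (CompletedAlgCl E)) fun x => by
    rw [mem_integers]
    exact (norm_embed E x).trans_le x.2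

variable (p : ℕ) [Fact p.Prime] [hp : Fact (‖(p : E)‖ < 1)]

instance : Fact (‖(p : CompletedAlgCl E)‖ < 1) :=
  ⟨by rw [← map_natCast (embed E) p, norm_embed]; exact hp.out⟩

/-- The valuation ring `𝒪_F` of the tilt `F` of the completed algebraic closure of `E`. -/
abbrev TiltIntegers : Type u := PreTilt (integers (CompletedAlgCl E)) p

/-- The absolute value of the tilt. -/
noncomputable def tiltVal : Valuation (TiltIntegers E p) ℝ≥0 :=
  PreTilt.val (CompletedAlgCl E) NormedField.valuation (integers (CompletedAlgCl E))
    (Valuation.integer.integers _) p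

/-- The structure map `k → 𝒪_F`, obtained from `𝒪_E → 𝒪_C` by tilting. -/
noncomputable def tiltMap : PreTilt (integers E) p →+* TiltIntegers E p :=
  Perfection.map p (Ideal.quotientMap (Ideal.span {(p : integers (CompletedAlgCl E))})
    (embedIntegers E) (by
      rw [Ideal.span_singleton_le_iff_mem, Ideal.mem_comap, map_natCast]
      exact Ideal.mem_span_singleton_self _))

/-- The space `|𝒴_{F,E}|` for `F` the tilt of the completed algebraic closure of `E`. -/
abbrev TiltCurve : Type u := ClassicalPoint E p (tiltMap E p) (tiltVal E p)

end Closure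

end FarguesFontaine

namespace Arithmeticoid

open FarguesFontaine

variable {L : Type u} [Field L] [NumberField L]

/-! ### Local fields of a number field -/

/-- The residue characteristic of a finite place. -/
noncomputable def residueChar (v : HeightOneSpectrum (𝓞 L)) : ℕ := ringChar (𝓞 L ⧸ v.asIdeal)

instance (v : HeightOneSpectrum (𝓞 L)) : Fact (residueChar v).Prime :=
  haveI : CharP (𝓞 L ⧸ v.asIdeal) (residueChar v) := ringChar.charP _
  CharP.char_is_prime_or_zero (𝓞 L ⧸ v.asIdeal) (residueChar v) |>.elim Fact.mk fun h =>
    absurd h (CharP.char_ne_zero_of_finite (𝓞 L ⧸ v.asIdeal) _)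

/-- The completion `L_v` of `L` at a finite place `v`, with its normalised absolute value. -/
def LocalField (v : HeightOneSpectrum (𝓞 L)) : Type u := v.adicCompletion L

noncomputable instance (v : HeightOneSpectrum (𝓞 L)) : NontriviallyNormedField (LocalField v) :=
  Valued.toNontriviallyNormedField (v.adicCompletion L) (WithZero (Multiplicative ℤ))

instance (v : HeightOneSpectrum (𝓞 L)) : IsUltrametricDist (LocalField v) :=
  inferInstanceAs (IsUltrametricDist (v.adicCompletion L))

instance (v : HeightOneSpectrum (𝓞 L)) : CompleteSpace (LocalField v) :=
  inferInstanceAs (CompleteSpace (v.adicCompletion L))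

theorem norm_residueChar_lt_one (v : HeightOneSpectrum (𝓞 L)) :
    ‖(residueChar v : v.adicCompletion L)‖ < 1 := by
  have h : ((residueChar v : ℕ) : 𝓞 L) ∈ v.asIdeal := by
    rw [← Ideal.Quotient.eq_zero_iff_mem, map_natCast]
    exact ringChar.Nat.cast_ringChar
  have h2 := (FinitePlace.norm_lt_one_iff_mem L v ((residueChar v : ℕ) : 𝓞 L)).2 h
  rwa [map_natCast, map_natCast] at h2

instance (v : HeightOneSpectrum (𝓞 L)) : Fact (‖(residueChar v : LocalField v)‖ < 1) :=
  ⟨norm_residueChar_lt_one v⟩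

/-- The factor `|𝒴_{F_v, L_v}|` at a finite place `v`, for `F_v` the tilt of the completed
algebraic closure of `L_v`. -/
abbrev LocalCurve (v : HeightOneSpectrum (𝓞 L)) : Type u :=
  TiltCurve (LocalField v) (residueChar v)

variable (L)

/-- The set `𝕍_L` of places of `L`. -/
abbrev Place : Type u := HeightOneSpectrum (𝓞 L) ⊕ InfinitePlace L

/-- The adelic Fargues–Fontaine curve `𝒴_L`: the product over all places of `L` of the local
curves at the finite places, and of the archimedean curve `ℝ_{>0}` at the infinite places, with
the product topology. Its points are the arithmeticoids of `L`. -/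
abbrev AdelicCurve : Type u :=
  ((v : HeightOneSpectrum (𝓞 L)) → LocalCurve v) × (InfinitePlace L → Set.Ioi (0 : ℝ))

variable {L}

/-- The product `∏_v |𝒴_{F_v, L_v}|` for an arbitrary family of fields `F_v` of characteristic `p_v`
at the finite places (with `F_v = L_v = ℂ` and factor `ℝ_{>0}` at the infinite places). -/
abbrev AdelicCurveOf (F : HeightOneSpectrum (𝓞 L) → Type w)
    [∀ v, NontriviallyNormedField (F v)] [∀ v, IsUltrametricDist (F v)]
    (i : (v : HeightOneSpectrum (𝓞 L)) →
      PreTilt (integers (LocalField v)) (residueChar v) →+* integers (F v)) :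
    Type (max u w) :=
  ((v : HeightOneSpectrum (𝓞 L)) → Curve (LocalField v) (residueChar v) (F v) (i v)) ×
    (InfinitePlace L → Set.Ioi (0 : ℝ))

/-- The standard distance on the countable product `𝒴_L`, for an enumeration `e` of the places:
the sum over all places `v` of `min (2 ^ (-e v), d_v (y_v, z_v))`. -/
noncomputable def distance (e : Place L → ℕ) (y z : AdelicCurve L) : ℝ :=
  (∑' v : HeightOneSpectrum (𝓞 L),
      min ((1 / 2 : ℝ) ^ e (Sum.inl v)) ((y.1 v).distance (z.1 v))) +
    ∑ v : InfinitePlace L, min ((1 / 2 : ℝ) ^ e (Sum.inr v)) (dist (y.2 v) (z.2 v))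

end Arithmeticoid

/-! The point is that the Fargues–Fontaine distance d is an ultrametric on each finite factor. The
places are countable, since the ring of integers is a countable Noetherian ring, so the weighted sum
then metrises the product.

Rewritten through ideals (`distance_eq`), d(y₁, y₂) is the infimum of the |z| with 𝔪_{y₁} ⊆ ([z]) +
𝔪_{y₂}. In this form d(y, y) = 0 and the strong triangle inequality are formal, because |z| ≤ |w|
means w ∣ z. The other two axioms use the arithmetic of A, with ξᵢ = [aᵢ] + πuᵢ.

Symmetry (`isUnit_of_eq_mul_add`): suppose ξ₁ = cξ₂ + [z]g with z not a unit. Modulo the maximal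
ideal of 𝒪_F all Teichmüller terms vanish and πu₁ = cπu₂ remains, so c is a unit and the relation
can be solved for ξ₂.

Separation (`mem_span_of_forall_pow`): if d(y₁, y₂) = 0, then 𝔪_{y₁} ⊆ ([a₂]ⁿ) + (ξ₂) for all n.
Since [a₂] ≡ -πu₂ modulo ξ₂, it lies in (πⁿ) + (ξ₂) for all n. As A/(ξ₂) is π-adically separated,
𝔪_{y₁} ⊆ (ξ₂).

These arguments need only that A is p-adically complete, that π is regular, that A/π = 𝒪_F, and that
p and π have the same radical: this is `IsUniformized`. It holds for 𝒪_E ⊗ W(𝒪_F) because W(𝒪_F) is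
flat and 𝒪_E finite free over W(k). -/

namespace FarguesFontaine

/-! ### Units and separatedness in a ring uniformised by π -/

/-- The properties of `A = W_{𝒪_E}(O)`, of its uniformizer `π` and of the reduction `φ : A → O`
modulo `π` on which the distance depends. -/
structure IsUniformized {p : ℕ} [Fact p.Prime] {O : Type*} {A : Type*} [CommRing O] [CommRing A]
    (j : WittVector p O →+* A) (π : A) (φ : A →+* O) : Prop where
  map_witt : ∀ x, φ (j x) = x.coeff 0
  map_uniformizer : φ π = 0
  dvd_of_map_eq_zero : ∀ t, φ t = 0 → π ∣ t
  eq_zero_of_mul : ∀ t, π * t = 0 → t = 0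
  dvd_natCast : π ∣ (p : A)
  natCast_dvd_pow : ∃ e : ℕ, (p : A) ∣ π ^ e
  isAdicComplete : IsAdicComplete (Ideal.span {(p : A)}) A

namespace IsUniformized

variable {p : ℕ} [Fact p.Prime] {O : Type*} {A : Type*} [CommRing O] [CommRing A]
  {j : WittVector p O →+* A} {π : A} {φ : A →+* O}

-- A power of π lies in (p), hence in the Jacobson radical by p-adic completeness, and that radical
-- ideal then contains π. Lifting an inverse of φ c by Teichmüller gives a product 1 + πt, a unit.
include j in
theorem isUnit_of_isUnit_map (h : IsUniformized j π φ) {c : A} (hc : IsUnit (φ c)) :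
    IsUnit c := by
  have hπ : π ∈ (⊥ : Ideal A).jacobson := by
    obtain ⟨e, he⟩ := h.natCast_dvd_pow
    have := h.isAdicComplete
    have h1 : π ^ e ∈ (⊥ : Ideal A).jacobson :=
      IsAdicComplete.le_jacobson_bot (Ideal.span {(p : A)}) (Ideal.mem_span_singleton.2 he)
    exact Ideal.isRadical_jacobson _ ⟨e, h1⟩
  obtain ⟨d, hd⟩ := hc.exists_right_inv
  have hsurj : φ (j (WittVector.teichmuller p d)) = d := by
    rw [h.map_witt, WittVector.teichmuller_coeff_zero]
  obtain ⟨t, ht⟩ := h.dvd_of_map_eq_zero (c * j (WittVector.teichmuller p d) - 1) (by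
    rw [map_sub, map_mul, hsurj, hd, map_one, sub_self])
  have h2 : IsUnit (π * t + 1) := Ideal.mem_jacobson_bot.1 hπ t
  rw [← ht, sub_add_cancel] at h2
  exact isUnit_of_mul_isUnit_left h2

theorem exists_eq_teichmuller_add (h : IsUniformized j π φ) (c : A) :
    ∃ d, c = j (WittVector.teichmuller p (φ c)) + π * d := by
  obtain ⟨d, hd⟩ := h.dvd_of_map_eq_zero (c - j (WittVector.teichmuller p (φ c))) (by
    rw [map_sub, h.map_witt, WittVector.teichmuller_coeff_zero, sub_self])
  exact ⟨d, by rw [← hd]; ring⟩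

/-- If `ξ₁ ≡ c ξ₂` modulo `[z]`, for primitive elements `ξ₁`, `ξ₂` of degree one and a non-unit `z`,
then `c` is a unit. -/
theorem isUnit_of_eq_mul_add [IsLocalRing O] [CharP O p] [PerfectRing O p]
    (h : IsUniformized j π φ) {a₁ a₂ z : O}
    (ha₁ : ¬ IsUnit a₁) (ha₂ : ¬ IsUnit a₂) (hz : ¬ IsUnit z) (u₁ u₂ : Aˣ) {c g : A}
    (H : j (WittVector.teichmuller p a₁) + π * u₁ =
      c * (j (WittVector.teichmuller p a₂) + π * u₂) + j (WittVector.teichmuller p z) * g) :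
    IsUnit c := by
  by_contra hc
  have hc0 : ¬ IsUnit (φ c) := fun h' => hc (h.isUnit_of_isUnit_map h')
  set T := WittVector.teichmuller (R := O) p with hT
  let r := IsLocalRing.residue O
  have hr : ∀ {x : O}, ¬ IsUnit x → r x = 0 := fun {x} hx =>
    (IsLocalRing.residue_eq_zero_iff x).2 ((IsLocalRing.mem_maximalIdeal x).2 hx)
  have : CharP (IsLocalRing.ResidueField O) p :=
    (CharP.charP_iff_prime_eq_zero Fact.out).2 (by rw [← map_natCast r, CharP.cast_eq_zero, map_zero])
  have hmT : ∀ {x : O}, ¬ IsUnit x → WittVector.map r (T x) = 0 := fun {x} hx => by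
    rw [hT, WittVector.map_teichmuller, hr hx, WittVector.teichmuller_zero]
  obtain ⟨c', hc'⟩ := h.exists_eq_teichmuller_add c
  obtain ⟨g', hg'⟩ := h.exists_eq_teichmuller_add g
  obtain ⟨q, hq⟩ := h.dvd_natCast
  rw [← hT] at hc' hg'
  have h0 := congrArg φ H
  simp only [map_add, map_mul, h.map_witt, h.map_uniformizer, hT,
    WittVector.teichmuller_coeff_zero, zero_mul, add_zero] at h0
  -- In W(O), divisibility by p is detected by the zeroth coefficient, which vanishes here by the
  -- relation modulo π.
  obtain ⟨w, hw⟩ : (p : WittVector p O) ∣ T a₁ - T (φ c) * T a₂ - T z * T (φ g) := by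
    rw [← Ideal.mem_span_singleton, WittVector.mem_span_p_iff_coeff_zero_eq_zero]
    have hT0 : ∀ x, WittVector.constantCoeff (p := p) (R := O) (T x) = x := WittVector.teichmuller_coeff_zero p
    have : WittVector.constantCoeff (T a₁ - T (φ c) * T a₂ - T z * T (φ g)) = 0 := by
      rw [map_sub, map_sub, map_mul, map_mul, hT0, hT0, hT0, hT0, hT0, h0]
      ring
    exact this
  -- Over the residue field the three Teichmüller terms die and p is regular, so w itself dies: the
  -- carry w contributes nothing to the next coefficient.
  have hw0 : r (w.coeff 0) = 0 := by
    have h1 := congrArg (WittVector.map r) hw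
    rw [map_sub, map_sub, map_mul, map_mul, map_mul, hmT ha₁, hmT hc0, hmT hz, map_natCast] at h1
    have h2 : WittVector.map r w = 0 := by
      have h3 : (p : WittVector p (IsLocalRing.ResidueField O)) * WittVector.map r w = 0 := by
        rw [← h1]; ring
      exact (mul_eq_zero.1 h3).resolve_left (WittVector.p_nonzero p _)
    rw [← WittVector.map_coeff, h2, WittVector.zero_coeff]
  have hj : j (T a₁) - j (T (φ c)) * j (T a₂) - j (T z) * j (T (φ g)) = π * q * j w := by
    have := congrArg j hw
    simpa only [map_sub, map_mul, map_natCast, hq] using this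
  -- The relation divided by π. In the residue field of O only u₁ survives, so the unit u₁ would
  -- reduce to zero.
  have h4 : q * j w + u₁ - j (T (φ c)) * u₂ - c' * j (T a₂) - π * c' * u₂ - j (T z) * g' = 0 := by
    apply h.eq_zero_of_mul
    have : j (T a₁) + π * u₁ = (j (T (φ c)) + π * c') * (j (T a₂) + π * u₂) +
        j (T z) * (j (T (φ g)) + π * g') := by rw [← hc', ← hg']; exact H
    linear_combination this - hj
  have h5 := congrArg (fun x => r (φ x)) h4
  simp only [map_add, map_sub, map_mul, h.map_witt, h.map_uniformizer, hT,
    WittVector.teichmuller_coeff_zero, hw0, hr hc0, hr ha₂, hr hz, map_zero, mul_zero, zero_mul,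
    zero_add, sub_zero] at h5
  exact ((u₁.isUnit.map φ).map r).ne_zero h5

/-- Multiplication by ξ is injective on A/π = O, a domain; since π is regular this passes to A/πⁿ by
induction. -/
theorem pow_dvd_of_pow_dvd_mul [IsDomain O] (h : IsUniformized j π φ) {ξ : A} (hξ : φ ξ ≠ 0)
    (n : ℕ) {t : A} (ht : π ^ n ∣ ξ * t) : π ^ n ∣ t := by
  induction n generalizing t with
  | zero => simp
  | succ n ih =>
    obtain ⟨s, hs⟩ := ht
    have h1 : φ t = 0 := by
      have := congrArg φ hs
      rw [map_mul, map_mul, map_pow, h.map_uniformizer, zero_pow (by omega), zero_mul] at this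
      exact (mul_eq_zero.1 this).resolve_left hξ
    obtain ⟨t', rfl⟩ := h.dvd_of_map_eq_zero t h1
    rw [pow_succ']
    refine mul_dvd_mul_left _ (ih ⟨s, ?_⟩)
    refine sub_eq_zero.1 (h.eq_zero_of_mul _ ?_)
    linear_combination hs

/-- The quotient of `A` by an element `ξ` whose reduction is not zero is `π`-adically separated. -/
theorem mem_span_of_forall_pow [IsDomain O] (h : IsUniformized j π φ) {ξ : A} (hξ : φ ξ ≠ 0)
    {f : A} (hf : ∀ n : ℕ, f ∈ Ideal.span {π ^ n} ⊔ Ideal.span {ξ}) : f ∈ Ideal.span {ξ} := by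
  have := h.isAdicComplete
  obtain ⟨e, he⟩ := h.natCast_dvd_pow
  have hI : ∀ n (x : A), x ∈ Ideal.span {(p : A)} ^ n ↔ (p : A) ^ n ∣ x := fun n x => by
    rw [Ideal.span_singleton_pow, Ideal.mem_span_singleton]
  -- The exponent e * n ensures that πᵉⁿ is divisible by pⁿ. By the cancellation lemma the
  -- approximate quotients s n are p-adically Cauchy, and their limit is f / ξ.
  have key : ∀ n : ℕ, ∃ s : A, π ^ (e * n) ∣ f - ξ * s := fun n => by
    obtain ⟨x, hx, y, hy, hxy⟩ := Submodule.mem_sup.1 (hf (e * n))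
    rw [Ideal.mem_span_singleton] at hx hy
    obtain ⟨s, rfl⟩ := hy
    exact ⟨s, by rwa [← hxy, add_sub_cancel_right]⟩
  choose s hs using key
  have hpow : ∀ n, (p : A) ^ n ∣ π ^ (e * n) := fun n => by
    rw [pow_mul]
    exact pow_dvd_pow_of_dvd he n
  have hcauchy : ∀ {m n : ℕ}, m ≤ n → s m ≡ s n [SMOD (Ideal.span {(p : A)} ^ m • ⊤ : Ideal A)] := by
    intro m n hmn
    rw [SModEq.sub_mem, smul_eq_mul, Ideal.mul_top, hI]
    refine (hpow m).trans (h.pow_dvd_of_pow_dvd_mul hξ _ ?_)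
    have := dvd_sub ((pow_dvd_pow π (Nat.mul_le_mul_left e hmn)).trans (hs n)) (hs m)
    convert this using 1
    ring
  obtain ⟨l, hl⟩ := IsPrecomplete.prec' _ hcauchy
  have : f - ξ * l = 0 := by
    refine IsHausdorff.haus' (I := Ideal.span {(p : A)}) _ fun n => ?_
    rw [SModEq.zero, smul_eq_mul, Ideal.mul_top, hI]
    have h1 := hl n
    rw [SModEq.sub_mem, smul_eq_mul, Ideal.mul_top, hI] at h1
    have h2 := dvd_add ((hpow n).trans (hs n)) (h1.mul_left ξ)
    convert h2 using 1
    ring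
  rw [Ideal.mem_span_singleton]
  exact ⟨l, sub_eq_zero.1 this⟩

end IsUniformized

end FarguesFontaine

namespace FarguesFontaine

/-! ### Adic completeness and finite generation -/

section AdicComplete

theorem smodEq_span_singleton_pow_iff {R M : Type*} [CommRing R] [AddCommGroup M] [Module R M]
    (r : R) (n : ℕ) (x y : M) :
    x ≡ y [SMOD (Ideal.span {r} ^ n • ⊤ : Submodule R M)] ↔ ∃ z, x - y = r ^ n • z := by
  rw [SModEq.sub_mem, Ideal.span_singleton_pow, Submodule.ideal_span_singleton_smul,
    Submodule.mem_smul_pointwise_iff_exists]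
  simp [eq_comm]

/-- For a principal ideal, divisibility by rⁿ is checked coordinate by coordinate, so the index set
need not be finite. -/
theorem isAdicComplete_pi {R ι : Type*} [CommRing R] (r : R)
    [IsAdicComplete (Ideal.span {r}) R] : IsAdicComplete (Ideal.span {r}) (ι → R) where
  haus' x hx := by
    ext i
    refine IsHausdorff.haus' (I := Ideal.span {r}) (x i) fun n => ?_
    obtain ⟨z, hz⟩ := (smodEq_span_singleton_pow_iff r n _ _).1 (hx n)
    exact (smodEq_span_singleton_pow_iff r n _ _).2 ⟨z i, congrFun hz i⟩
  prec' f hf := by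
    have : ∀ i, ∃ l, ∀ n, f n i ≡ l [SMOD (Ideal.span {r} ^ n • ⊤ : Submodule R R)] := fun i => by
      refine IsPrecomplete.prec' (fun n => f n i) fun {m n} hmn => ?_
      obtain ⟨z, hz⟩ := (smodEq_span_singleton_pow_iff r m _ _).1 (hf hmn)
      exact (smodEq_span_singleton_pow_iff r m _ _).2 ⟨z i, congrFun hz i⟩
    choose l hl using this
    refine ⟨l, fun n => ?_⟩
    have h : ∀ i, ∃ z, f n i - l i = r ^ n • z := fun i =>
      (smodEq_span_singleton_pow_iff r n _ _).1 (hl i n)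
    choose z hz using h
    exact (smodEq_span_singleton_pow_iff r n _ _).2 ⟨z, funext hz⟩

theorem isAdicComplete_of_linearEquiv {R M N : Type*} [CommRing R] [AddCommGroup M] [Module R M]
    [AddCommGroup N] [Module R N] (e : M ≃ₗ[R] N) (r : R) [IsAdicComplete (Ideal.span {r}) N] :
    IsAdicComplete (Ideal.span {r}) M where
  haus' x hx := by
    rw [← e.map_eq_zero_iff]
    refine IsHausdorff.haus' (I := Ideal.span {r}) _ fun n => ?_
    obtain ⟨z, hz⟩ := (smodEq_span_singleton_pow_iff r n _ _).1 (hx n)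
    exact (smodEq_span_singleton_pow_iff r n _ _).2 ⟨e z, by simpa using congrArg e hz⟩
  prec' f hf := by
    obtain ⟨l, hl⟩ := IsPrecomplete.prec' (I := Ideal.span {r}) (fun n => e (f n)) fun {m n} hmn => by
      obtain ⟨z, hz⟩ := (smodEq_span_singleton_pow_iff r m _ _).1 (hf hmn)
      exact (smodEq_span_singleton_pow_iff r m _ _).2 ⟨e z, by simpa using congrArg e hz⟩
    refine ⟨e.symm l, fun n => ?_⟩
    obtain ⟨z, hz⟩ := (smodEq_span_singleton_pow_iff r n _ _).1 (hl n)
    exact (smodEq_span_singleton_pow_iff r n _ _).2 ⟨e.symm z, by simpa using congrArg e.symm hz⟩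

/-- A ring which is `r`-adically separated and in which `r` divides a power of `π` is a finite
module over an `r`-adically complete ring that surjects onto its reduction modulo `π`. -/
theorem finite_of_surjective_mod {S B : Type*} [CommRing S] [CommRing B] [Algebra S B] (r : S)
    [IsAdicComplete (Ideal.span {r}) S] [IsHausdorff (Ideal.span {r}) B] {π : B}
    (hπ : ∀ b : B, ∃ s : S, π ∣ b - algebraMap S B s) {e : ℕ} (he : algebraMap S B r ∣ π ^ e) :
    Module.Finite S B := by
  have expand : ∀ (n : ℕ) (b : B), ∃ (s : Fin n → S) (c : B),
      b = ∑ j, s j • π ^ (j : ℕ) + π ^ n * c := by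
    intro n b
    induction n with
    | zero => exact ⟨fun _ => 0, b, by simp⟩
    | succ n ih =>
      obtain ⟨s, c, h⟩ := ih
      obtain ⟨t, d, hd⟩ := hπ c
      refine ⟨Fin.snoc s t, d, ?_⟩
      rw [Fin.sum_univ_castSucc]
      simp only [Fin.snoc_castSucc, Fin.val_castSucc, Fin.snoc_last, Fin.val_last]
      rw [h, Algebra.smul_def t]
      linear_combination π ^ n * hd
  have := isAdicComplete_pi (ι := Fin e) r
  refine Module.Finite.of_surjective (Fintype.linearCombination S (fun j : Fin e => π ^ (j : ℕ))) ?_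
  -- Completeness of the source and separatedness of the target reduce surjectivity to a statement
  -- modulo r, where the remainder πᵉc of the expansion vanishes.
  refine surjective_of_mkQ_comp_surjective (I := Ideal.span {r}) fun y => ?_
  obtain ⟨b, rfl⟩ := Submodule.mkQ_surjective _ y
  obtain ⟨s, c, h⟩ := expand e b
  refine ⟨s, ?_⟩
  rw [LinearMap.comp_apply, Submodule.mkQ_apply, Submodule.mkQ_apply, eq_comm,
    Submodule.Quotient.eq]
  have h1 := (smodEq_span_singleton_pow_iff r 1 b
    (Fintype.linearCombination S (fun j : Fin e => π ^ (j : ℕ)) s)).2 ?_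
  · rwa [pow_one, SModEq.sub_mem] at h1
  · obtain ⟨q, hq⟩ := he
    refine ⟨q * c, ?_⟩
    rw [Fintype.linearCombination_apply, pow_one, Algebra.smul_def]
    linear_combination h + c * hq

end AdicComplete

/-! ### The ring 𝒪_E ⊗ W(O) is uniformised -/

section TensorProduct

open TensorProduct

/-- The field property is a proposition because k will be a tilt, whose ring structure is already
fixed. -/
theorem isDiscreteValuationRing_wittVector {p : ℕ} [Fact p.Prime] {k : Type*} [CommRing k]
    [CharP k p] [PerfectRing k p] (hk : IsField k) :
    letI := hk.isDomain
    IsDiscreteValuationRing (WittVector p k) := by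
  let := hk.toField
  exact WittVector.isDiscreteValuationRing

theorem injective_wittVector_of_natCast_ne_zero {p : ℕ} [Fact p.Prime] {k B : Type*} [CommRing k]
    [CharP k p] [PerfectRing k p] (hk : IsField k) [CommRing B] [IsDomain B]
    (f : WittVector p k →+* B) (hp : (p : B) ≠ 0) : Function.Injective f := by
  let := hk.toField
  rw [injective_iff_map_eq_zero]
  intro x hx
  by_contra hx0
  obtain ⟨n, u, rfl⟩ := WittVector.exists_eq_pow_p_mul' x hx0
  rw [map_mul, map_pow, map_natCast, mul_eq_zero] at hx
  exact hx.elim (pow_ne_zero n hp) (u.isUnit.map f).ne_zero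

variable {p : ℕ} [Fact p.Prime] {k O B : Type*} [CommRing k] [CharP k p] [PerfectRing k p]
  [CommRing O] [IsDomain O] [CharP O p] [PerfectRing O p] [CommRing B] [IsDomain B]

/-- B is torsion-free and, by π-adic expansion, finite over the discrete valuation ring W(k), hence
free; W(O) is torsion-free, hence flat. The map φ is b ⊗ w ↦ i(ρ b) w₀. -/
theorem isUniformized_tensorProduct (hk : IsField k) (i : k →+* O) (θ : WittVector p k →+* B)
    (ρ : B →+* k) (hρ : ∀ x, ρ (θ x) = x.coeff 0) {π : B} (hπ : ∀ b, ρ b = 0 ↔ π ∣ b)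
    (hπ0 : π ≠ 0) (hp : (p : B) ≠ 0) (hpπ : ∃ e : ℕ, (p : B) ∣ π ^ e)
    [IsAdicComplete (Ideal.span {(p : B)}) B] :
    letI := θ.toAlgebra
    letI := (WittVector.map (p := p) i).toAlgebra
    ∃ φ : B ⊗[WittVector p k] WittVector p O →+* O,
      IsUniformized (p := p)
        (RingHomClass.toRingHom (Algebra.TensorProduct.includeRight :
          WittVector p O →ₐ[WittVector p k] B ⊗[WittVector p k] WittVector p O))
        (Algebra.TensorProduct.includeLeftRingHom π) φ := by
  let := θ.toAlgebra
  let := (WittVector.map (p := p) i).toAlgebra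
  let := hk.isDomain
  let : Algebra (WittVector p k) O := (i.comp WittVector.constantCoeff).toAlgebra
  have := isDiscreteValuationRing_wittVector (p := p) hk
  let S := WittVector p k
  let W := WittVector p O
  have hθ : Function.Injective (algebraMap S B) := injective_wittVector_of_natCast_ne_zero hk θ hp
  have hi : Function.Injective i := by
    let := hk.toField
    exact i.injective
  have hW : Function.Injective (algebraMap S W) := WittVector.map_injective i hi
  have : FaithfulSMul S B := (faithfulSMul_iff_algebraMap_injective S B).2 hθ
  have : FaithfulSMul S W := (faithfulSMul_iff_algebraMap_injective S W).2 hW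
  have : Module.IsTorsionFree S B := inferInstance
  have : Module.IsTorsionFree S W := inferInstance
  have : Module.Flat S W := inferInstance
  have hρθ : ∀ b, ∃ x : S, π ∣ b - algebraMap S B x := fun b => by
    refine ⟨WittVector.teichmuller p (ρ b), ?_⟩
    rw [← hπ, map_sub, RingHom.algebraMap_toAlgebra, hρ, WittVector.teichmuller_coeff_zero, sub_self]
  obtain ⟨e, he⟩ := hpπ
  have : IsAdicComplete (Ideal.span {(p : S)}) S := WittVector.isAdicCompleteIdealSpanP
  have : IsAdicComplete (Ideal.span {(p : W)}) W := WittVector.isAdicCompleteIdealSpanP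
  have hB : IsAdicComplete (Ideal.span {(p : S)}) B := by
    rw [← IsAdicComplete.map_algebraMap_iff (S := B)]
    rwa [Ideal.map_span, Set.image_singleton, map_natCast]
  have : Module.Finite S B :=
    finite_of_surjective_mod (p : S) (π := π) hρθ (e := e) (by rwa [map_natCast])
  have : Module.Free S B := inferInstance
  let f : B →ₐ[S] O := { i.comp ρ with
    commutes' := fun x => congrArg i (hρ x) }
  let g : W →ₐ[S] O := { WittVector.constantCoeff with
    commutes' := fun x => WittVector.map_coeff i x 0 }
  let φ : B ⊗[S] W →ₐ[S] O := Algebra.TensorProduct.productMap f g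
  let π' : B ⊗[S] W := π ⊗ₜ 1
  have hφf : ∀ b w, φ (b ⊗ₜ w) = i (ρ b) * w.coeff 0 := fun b w =>
    Algebra.TensorProduct.productMap_apply_tmul _ _ _ _
  have halg : ∀ (x : S) (w : W), algebraMap S B x ⊗ₜ[S] w = 1 ⊗ₜ (algebraMap S W x * w) :=
    fun x w => by rw [Algebra.algebraMap_eq_smul_one, ← Algebra.smul_def, smul_tmul]
  -- Since W(k) surjects onto B/π, every tensor is 1 ⊗ w modulo π. Thus the kernel of φ is governed
  -- by w₀, and w₀ = 0 forces p, hence π, to divide 1 ⊗ w.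
  have hdecomp : ∀ t : B ⊗[S] W, ∃ (w : W) (t' : B ⊗[S] W), t = 1 ⊗ₜ w + π' * t' := by
    intro t
    induction t with
    | zero => exact ⟨0, 0, by simp⟩
    | tmul b w =>
      obtain ⟨x, c, hc⟩ := hρθ b
      refine ⟨algebraMap S W x * w, c ⊗ₜ w, ?_⟩
      rw [sub_eq_iff_eq_add'.1 hc, Algebra.TensorProduct.tmul_mul_tmul, one_mul, add_tmul,
        halg]
    | add t₁ t₂ h₁ h₂ =>
      obtain ⟨w₁, t₁', rfl⟩ := h₁
      obtain ⟨w₂, t₂', rfl⟩ := h₂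
      exact ⟨w₁ + w₂, t₁' + t₂', by rw [tmul_add]; ring⟩
  refine ⟨φ.toRingHom, ?_, ?_, ?_, ?_, ?_, ?_, ?_⟩
  · intro x
    change φ (1 ⊗ₜ x) = _
    rw [hφf, map_one, map_one, one_mul]
  · change φ (π ⊗ₜ 1) = _
    rw [hφf, (hπ π).2 dvd_rfl, map_zero, zero_mul]
  · intro t ht
    obtain ⟨w, t', rfl⟩ := hdecomp t
    have h0 : φ (1 ⊗ₜ w) = 0 := by
      have : φ (1 ⊗ₜ w + π' * t') = 0 := ht
      rwa [map_add, map_mul, show φ π' = 0 by rw [hφf, (hπ π).2 dvd_rfl, map_zero, zero_mul],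
        zero_mul, add_zero] at this
    rw [hφf, map_one, map_one, one_mul, ← WittVector.mem_span_p_iff_coeff_zero_eq_zero,
      Ideal.mem_span_singleton] at h0
    obtain ⟨w', rfl⟩ := h0
    obtain ⟨q, hq⟩ : π ∣ (p : B) := by rw [← hπ, map_natCast, CharP.cast_eq_zero]
    refine Dvd.dvd.add ⟨q ⊗ₜ w', ?_⟩ (dvd_mul_right _ _)
    have := halg p w'
    rw [map_natCast, map_natCast] at this
    rw [← this, hq, Algebra.TensorProduct.includeLeftRingHom_apply,
      Algebra.TensorProduct.tmul_mul_tmul, one_mul]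
  · intro t ht
    -- Regularity of π in B survives tensoring with the flat module W(O).
    have hinj : Function.Injective (LinearMap.rTensor W (LinearMap.mulLeft S π)) :=
      Module.Flat.rTensor_preserves_injective_linearMap _ (mul_right_injective₀ hπ0)
    have hmul : ∀ t : B ⊗[S] W, LinearMap.rTensor W (LinearMap.mulLeft S π) t = π' * t := by
      intro t
      induction t with
      | zero => simp
      | tmul b w => simp [π']
      | add t₁ t₂ h₁ h₂ => rw [map_add, h₁, h₂, mul_add]
    exact hinj (by rw [hmul, map_zero]; exact ht)
  · obtain ⟨q, hq⟩ : π ∣ (p : B) := by rw [← hπ, map_natCast, CharP.cast_eq_zero]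
    rw [← map_natCast (Algebra.TensorProduct.includeLeftRingHom (R := S) (A := B) (B := W)) p]
    exact map_dvd _ ⟨q, hq⟩
  · refine ⟨e, ?_⟩
    rw [← map_natCast (Algebra.TensorProduct.includeLeftRingHom (R := S) (A := B) (B := W)) p,
      ← map_pow]
    exact map_dvd _ he
  -- A basis of B over W(k) becomes a basis of the tensor product over W(O), so the latter is a
  -- finite power of the p-adically complete ring W(O).
  · let := (RingHomClass.toRingHom (Algebra.TensorProduct.includeRight : W →ₐ[S] B ⊗[S] W)).toAlgebra
    let E := Algebra.TensorProduct.comm S B W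
    let ε : B ⊗[S] W ≃ₗ[W] W ⊗[S] B := { E.toRingEquiv.toAddEquiv with
      map_smul' := fun w t => by
        rw [Algebra.smul_def]
        change E ((1 ⊗ₜ w) * t) = w • E t
        rw [map_mul, Algebra.TensorProduct.comm_tmul, Algebra.smul_def]
        rfl }
    let b := (Module.finBasis S B).baseChange W
    have := isAdicComplete_pi (ι := Fin (Module.finrank S B)) (p : W)
    have := isAdicComplete_of_linearEquiv (ε.trans b.equivFun) (p : W)
    have := IsAdicComplete.map_algebraMap_iff (S := B ⊗[S] W) (M := B ⊗[S] W) (I := Ideal.span {(p : W)})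
    rw [Ideal.map_span, Set.image_singleton, map_natCast] at this
    exact this.2 ‹_›

end TensorProduct

end FarguesFontaine

namespace FarguesFontaine

/-! ### The tilt of 𝒪_E is its residue field -/

section PreTilt

variable {B : Type*} [CommRing B] {p : ℕ} [Fact p.Prime] [Fact (¬ IsUnit (p : B))] {π : B}

/-- The reduction modulo `π` of the zeroth coefficient of an element of the tilt. -/
noncomputable def preTiltReduction (hπp : π ∣ (p : B)) : PreTilt B p →+* B ⧸ Ideal.span {π} :=
  (Ideal.Quotient.factor ((Ideal.span_singleton_le_span_singleton).2 hπp)).comp (PreTilt.coeff 0)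

theorem preTiltReduction_eq_zero_iff (hπp : π ∣ (p : B)) (x : PreTilt B p) {b : B}
    (hb : Ideal.Quotient.mk _ b = PreTilt.coeff 0 x) : preTiltReduction hπp x = 0 ↔ π ∣ b := by
  rw [preTiltReduction, RingHom.comp_apply, ← hb, Ideal.Quotient.factor_mk,
    Ideal.Quotient.eq_zero_iff_mem, Ideal.mem_span_singleton]

theorem preTiltReduction_injective (hπ : Prime π) (hπp : π ∣ (p : B))
    (hpπ : ∃ e : ℕ, (p : B) ∣ π ^ e) : Function.Injective (preTiltReduction (p := p) hπp) := by
  obtain ⟨e, he⟩ := hpπ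
  rw [injective_iff_map_eq_zero]
  intro x hx
  refine Perfection.ext fun m => ?_
  -- Lifting the coefficient e places further up: primality gives π ∣ b, and coefficient m is the
  -- class of b ^ p ^ e, divisible by πᵉ and so by p.
  obtain ⟨b, hb⟩ := Ideal.Quotient.mk_surjective (PreTilt.coeff (m + e) x)
  have hpow : ∀ n k : ℕ, PreTilt.coeff (n + k) x ^ p ^ k = PreTilt.coeff n x := fun n k => by
    induction k with
    | zero => simp
    | succ k ih => rw [← add_assoc, pow_succ', pow_mul, PreTilt.coeff_pow_p, ih]
  have h1 : π ∣ b ^ p ^ (m + e) := by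
    rw [← preTiltReduction_eq_zero_iff hπp x, hx]
    rw [map_pow, hb]
    simpa using hpow 0 (m + e)
  obtain ⟨c, rfl⟩ := hπ.dvd_of_dvd_pow h1
  have h2 : PreTilt.coeff m x = 0 := by
    rw [← hpow m e, ← hb, ← map_pow, Ideal.Quotient.eq_zero_iff_mem, Ideal.mem_span_singleton,
      mul_pow]
    have : e ≤ p ^ e := (Nat.lt_pow_self (Fact.out : p.Prime).one_lt).le
    exact (he.trans (pow_dvd_pow π this)).mul_right _
  exact h2

theorem preTiltReduction_surjective (hπp : π ∣ (p : B)) (hpπ : ∃ e : ℕ, (p : B) ∣ π ^ e)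
    (hfrob : ∀ b : B, ∃ c, π ∣ b - c ^ p) :
    Function.Surjective (preTiltReduction (p := p) hπp) := by
  obtain ⟨e, he⟩ := hpπ
  intro y
  obtain ⟨b, rfl⟩ := Ideal.Quotient.mk_surjective y
  choose c hc using hfrob
  -- Successive p-th roots of b modulo π. They are compatible only modulo π; raising to the power p
  -- ^ e makes the error divisible by πᵉ, hence by p, which yields a genuine element of the tilt.
  let s : ℕ → B := fun n => c^[n] b
  have hs : ∀ n, π ∣ s n - s (n + 1) ^ p := fun n => by
    simp only [s, Function.iterate_succ_apply']
    exact hc _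
  let mk : B →+* ModP B p := Ideal.Quotient.mk _
  have hmk : ∀ n, mk (s (n + 1) ^ p) ^ p ^ e = mk (s n) ^ p ^ e := fun n => by
    rw [eq_comm, ← sub_eq_zero, ← sub_pow_char_pow, ← map_sub, ← map_pow]
    rw [Ideal.Quotient.eq_zero_iff_mem, Ideal.mem_span_singleton]
    have : e ≤ p ^ e := (Nat.lt_pow_self (Fact.out : p.Prime).one_lt).le
    exact (he.trans (pow_dvd_pow π this)).trans (pow_dvd_pow_of_dvd (hs n) _)
  let x : PreTilt B p := ⟨fun n => mk (s (n + e)) ^ p ^ e, fun n => by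
    change (mk (s (n + 1 + e)) ^ p ^ e) ^ p = mk (s (n + e)) ^ p ^ e
    rw [← hmk (n + e), map_pow, ← pow_mul, ← pow_mul, mul_comm, add_right_comm]⟩
  have hred : ∀ n, π ∣ s n ^ p ^ n - b := fun n => by
    induction n with
    | zero => simp [s]
    | succ n ih =>
      have := (hs n).trans (sub_dvd_pow_sub_pow _ _ (p ^ n))
      rw [← pow_mul, ← pow_succ'] at this
      have := dvd_sub ih this
      rwa [sub_sub_sub_cancel_left] at this
  refine ⟨x, ?_⟩
  have hx : PreTilt.coeff 0 x = Ideal.Quotient.mk _ (s e ^ p ^ e) := by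
    rw [map_pow]
    exact congrArg (fun t => mk (s t) ^ p ^ e) (zero_add e)
  rw [preTiltReduction, RingHom.comp_apply, hx, Ideal.Quotient.factor_mk, Ideal.Quotient.eq,
    Ideal.mem_span_singleton]
  exact hred e

variable [IsAdicComplete (Ideal.span {(p : B)}) B]

theorem exists_reduction_fontaineTheta (hπ : Prime π) (hmax : (Ideal.span {π}).IsMaximal)
    (hπp : π ∣ (p : B)) (hpπ : ∃ e : ℕ, (p : B) ∣ π ^ e) (hfrob : ∀ b : B, ∃ c, π ∣ b - c ^ p) :
    IsField (PreTilt B p) ∧ ∃ ρ : B →+* PreTilt B p, (∀ b, ρ b = 0 ↔ π ∣ b) ∧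
      ∀ x, ρ (WittVector.fontaineTheta B p x) = x.coeff 0 := by
  let E := RingEquiv.ofBijective (preTiltReduction (p := p) hπp)
    ⟨preTiltReduction_injective hπ hπp hpπ, preTiltReduction_surjective hπp hpπ hfrob⟩
  refine ⟨E.toMulEquiv.isField ((Ideal.Quotient.maximal_ideal_iff_isField_quotient _).1 hmax),
    E.symm.toRingHom.comp (Ideal.Quotient.mk _), fun b => ?_, fun x => ?_⟩
  · change E.symm _ = 0 ↔ _
    rw [map_eq_zero_iff _ E.symm.injective, Ideal.Quotient.eq_zero_iff_mem,
      Ideal.mem_span_singleton]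
  · change E.symm _ = _
    rw [RingEquiv.symm_apply_eq]
    change _ = preTiltReduction hπp _
    rw [preTiltReduction, RingHom.comp_apply, ← WittVector.mk_fontaineTheta,
      Ideal.Quotient.factor_mk]

end PreTilt

section Witt

variable {E : Type u} [NormedField E] [IsUltrametricDist E] [CompleteSpace E]
  {p : ℕ} [Fact p.Prime] [Fact (‖(p : E)‖ < 1)]
  {O : Type w} [CommRing O] [IsDomain O] [CharP O p] [PerfectRing O p]
  (i : PreTilt (integers E) p →+* O)

/-- The ring of ramified Witt vectors is uniformised by a uniformiser of `E` when `E` is discretely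
valued of characteristic zero with perfect residue field. -/
theorem RamifiedWitt.exists_isUniformized [IsDiscreteValuationRing (integers E)]
    (hp : (p : E) ≠ 0) (hfrob : ∀ b : integers E, ∃ c : integers E, ‖(b - c ^ p : E)‖ < 1)
    {π : integers E} (hπ : Irreducible π) :
    ∃ φ : RamifiedWitt E p i →+* O,
      IsUniformized (RamifiedWitt.ofWitt E p i) (RamifiedWitt.ofBase E p i π) φ := by
  have hp0 : (p : integers E) ≠ 0 := fun h => hp (by simpa using congrArg Subtype.val h)
  have hmax := hπ.maximalIdeal_eq
  have hdvd : ∀ b : integers E, ‖(b : E)‖ < 1 → π ∣ b := fun b hb => by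
    rw [← Ideal.mem_span_singleton, ← hmax, IsLocalRing.mem_maximalIdeal, mem_nonunits_iff]
    intro hu
    have h1 := (Valuation.integer.integers (NormedField.valuation (K := E))).one_of_isUnit hu
    exact hb.ne (congrArg NNReal.toReal h1)
  have hπp : π ∣ (p : integers E) := hdvd _ (by simpa using (Fact.out : ‖(p : E)‖ < 1))
  have hpπ : ∃ e : ℕ, (p : integers E) ∣ π ^ e := by
    obtain ⟨e, he⟩ := IsDiscreteValuationRing.associated_pow_irreducible hp0 hπ
    exact ⟨e, he.dvd⟩
  obtain ⟨hk, ρ, hρ, hθ⟩ := exists_reduction_fontaineTheta (p := p) hπ.prime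
    (hmax ▸ IsLocalRing.maximalIdeal.isMaximal _) hπp hpπ fun b => by
      obtain ⟨c, hc⟩ := hfrob b
      exact ⟨c, hdvd _ (by simpa using hc)⟩
  exact isUniformized_tensorProduct hk i _ ρ hθ hρ hπ.ne_zero hp0 hpπ

end Witt

end FarguesFontaine

namespace FarguesFontaine

/-! ### The distance on classical points is an ultrametric -/

section Metric

variable {E : Type u} [NormedField E] [IsUltrametricDist E] [CompleteSpace E]
  {p : ℕ} [Fact p.Prime] [Fact (‖(p : E)‖ < 1)]
  {O : Type w} [CommRing O] {i : PreTilt (integers E) p →+* O} {val : Valuation O ℝ≥0}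

theorem val_le_one (hval : ∀ x y, val x ≤ val y ↔ y ∣ x) (x : O) : val x ≤ 1 := by
  rw [← map_one val, hval]
  exact one_dvd x

theorem isUnit_iff_val_eq_one (hval : ∀ x y, val x ≤ val y ↔ y ∣ x) (x : O) :
    IsUnit x ↔ val x = 1 := by
  rw [isUnit_iff_dvd_one, ← hval, map_one]
  exact ⟨fun h => (val_le_one hval x).antisymm h, fun h => h.ge⟩

theorem isLocalRing_of_val [Nontrivial O] (hval : ∀ x y, val x ≤ val y ↔ y ∣ x) :
    IsLocalRing O := by
  refine IsLocalRing.of_nonunits_add fun a b ha hb => ?_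
  rw [mem_nonunits_iff, isUnit_iff_val_eq_one hval] at *
  exact ((val.map_add a b).trans_lt (max_lt ((val_le_one hval a).lt_of_ne ha)
    ((val_le_one hval b).lt_of_ne hb))).ne

namespace ClassicalPoint

theorem ideal_eq (y : ClassicalPoint E p i val) : y.ideal = Ideal.span {y.generator} :=
  y.2.choose_spec.2

/-- This removes the chosen generator: an element lies in an ideal exactly when the ideal it spans
does. -/
theorem distance_eq (y₁ y₂ : ClassicalPoint E p i val) :
    distance y₁ y₂ = sInf {r : ℝ | ∃ z : O,
      y₁.ideal ≤ Ideal.span {RamifiedWitt.teich E p i z} ⊔ y₂.ideal ∧ r = (val z : ℝ)} := by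
  simp only [distance, absAt, y₁.ideal_eq, Ideal.span_singleton_le_iff_mem]

theorem distance_bddBelow (y₁ y₂ : ClassicalPoint E p i val) :
    BddBelow {r : ℝ | ∃ z : O,
      y₁.ideal ≤ Ideal.span {RamifiedWitt.teich E p i z} ⊔ y₂.ideal ∧ r = (val z : ℝ)} :=
  ⟨0, by rintro _ ⟨z, -, rfl⟩; exact (val z).coe_nonneg⟩

theorem teich_one : RamifiedWitt.teich E p i 1 = 1 := by
  rw [RamifiedWitt.teich, map_one, map_one]

theorem le_span_teich_one_sup (y₁ y₂ : ClassicalPoint E p i val) :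
    y₁.ideal ≤ Ideal.span {RamifiedWitt.teich E p i 1} ⊔ y₂.ideal := by
  rw [teich_one, Ideal.span_singleton_one, top_sup_eq]
  exact le_top

theorem distance_nonempty (y₁ y₂ : ClassicalPoint E p i val) :
    {r : ℝ | ∃ z : O, y₁.ideal ≤ Ideal.span {RamifiedWitt.teich E p i z} ⊔ y₂.ideal ∧
      r = (val z : ℝ)}.Nonempty :=
  ⟨_, 1, y₁.le_span_teich_one_sup y₂, rfl⟩

theorem distance_le {y₁ y₂ : ClassicalPoint E p i val} {z : O}
    (h : y₁.ideal ≤ Ideal.span {RamifiedWitt.teich E p i z} ⊔ y₂.ideal) :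
    distance y₁ y₂ ≤ val z := by
  rw [distance_eq]
  exact csInf_le (distance_bddBelow y₁ y₂) ⟨z, h, rfl⟩

theorem distance_nonneg (y₁ y₂ : ClassicalPoint E p i val) : 0 ≤ distance y₁ y₂ := by
  rw [distance_eq]
  refine le_csInf (distance_nonempty y₁ y₂) ?_
  rintro _ ⟨z, -, rfl⟩
  exact (val z).coe_nonneg

theorem exists_of_distance_lt {y₁ y₂ : ClassicalPoint E p i val} {r : ℝ}
    (h : distance y₁ y₂ < r) :
    ∃ z : O, y₁.ideal ≤ Ideal.span {RamifiedWitt.teich E p i z} ⊔ y₂.ideal ∧ val z < r := by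
  rw [distance_eq] at h
  obtain ⟨_, ⟨z, hz, rfl⟩, hr⟩ := exists_lt_of_csInf_lt (distance_nonempty y₁ y₂) h
  exact ⟨z, hz, hr⟩

theorem distance_self (y : ClassicalPoint E p i val) : distance y y = 0 := by
  refine le_antisymm ?_ (distance_nonneg y y)
  simpa using distance_le (y₁ := y) (y₂ := y) (z := 0) le_sup_right

theorem span_teich_le_of_dvd {z w : O} (h : w ∣ z) :
    Ideal.span {RamifiedWitt.teich E p i z} ≤ Ideal.span {RamifiedWitt.teich E p i w} := by
  obtain ⟨c, rfl⟩ := h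
  rw [Ideal.span_singleton_le_span_singleton, RamifiedWitt.teich, RamifiedWitt.teich, map_mul,
    map_mul]
  exact dvd_mul_right _ _

theorem distance_le_max (hval : ∀ x y, val x ≤ val y ↔ y ∣ x)
    (y₁ y₂ y₃ : ClassicalPoint E p i val) :
    distance y₁ y₃ ≤ max (distance y₁ y₂) (distance y₂ y₃) := by
  refine le_of_forall_gt fun r hr => ?_
  rw [max_lt_iff] at hr
  obtain ⟨z, hz, hzr⟩ := exists_of_distance_lt hr.1
  obtain ⟨w, hw, hwr⟩ := exists_of_distance_lt hr.2
  rcases le_total (val z) (val w) with h | h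
  · refine (distance_le (z := w) ?_).trans_lt hwr
    exact hz.trans (sup_le ((span_teich_le_of_dvd ((hval _ _).1 h)).trans le_sup_left) hw)
  · refine (distance_le (z := z) ?_).trans_lt hzr
    exact hz.trans (sup_le le_sup_left
      (hw.trans (sup_le_sup_right (span_teich_le_of_dvd ((hval _ _).1 h)) _)))

variable [IsDiscreteValuationRing (integers E)]

/-- All primitive elements of degree one can be written with the same uniformiser. -/
theorem exists_ideal_eq {π : integers E} (hπ : Irreducible π) (y : ClassicalPoint E p i val) :
    ∃ (a : O) (u : (RamifiedWitt E p i)ˣ), a ≠ 0 ∧ val a < 1 ∧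
      y.ideal = Ideal.span {RamifiedWitt.ofWitt E p i (WittVector.teichmuller p a) +
        RamifiedWitt.ofBase E p i π * u} := by
  obtain ⟨ξ, ⟨ϖ, a, u, hϖ, ha0, ha, rfl⟩, hy⟩ := y.2
  obtain ⟨c, rfl⟩ := IsDiscreteValuationRing.associated_of_irreducible _ hπ hϖ
  refine ⟨a, Units.map (RamifiedWitt.ofBase E p i).toMonoidHom c * u, ha0, ha, ?_⟩
  rw [ideal, hy, map_mul, mul_assoc]
  rfl

variable [IsDomain O] [CharP O p] [PerfectRing O p]

theorem ideal_le_comm (hval : ∀ x y, val x ≤ val y ↔ y ∣ x) (hp : (p : E) ≠ 0)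
    (hfrob : ∀ b : integers E, ∃ c : integers E, ‖(b - c ^ p : E)‖ < 1)
    {y₁ y₂ : ClassicalPoint E p i val} {z : O}
    (h : y₁.ideal ≤ Ideal.span {RamifiedWitt.teich E p i z} ⊔ y₂.ideal) :
    y₂.ideal ≤ Ideal.span {RamifiedWitt.teich E p i z} ⊔ y₁.ideal := by
  -- For a unit z the ideal ([z]) is everything; the unit criterion for c applies only to non-units.
  by_cases hz : IsUnit z
  · have : Ideal.span {RamifiedWitt.teich E p i z} = ⊤ :=
      Ideal.span_singleton_eq_top.2 ((hz.map _).map _)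
    rw [this, top_sup_eq]
    exact le_top
  have hnu : ∀ {a : O}, val a < 1 → ¬ IsUnit a := fun ha => by
    rw [isUnit_iff_val_eq_one hval]
    exact ha.ne
  obtain ⟨π, hπ⟩ := IsDiscreteValuationRing.exists_irreducible (integers E)
  obtain ⟨φ, H⟩ := RamifiedWitt.exists_isUniformized i hp hfrob hπ
  obtain ⟨a₁, u₁, -, ha₁, h₁⟩ := y₁.exists_ideal_eq hπ
  obtain ⟨a₂, u₂, -, ha₂, h₂⟩ := y₂.exists_ideal_eq hπ
  have := isLocalRing_of_val hval
  rw [h₁, h₂, Ideal.span_singleton_le_iff_mem, Submodule.mem_sup] at h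
  rw [h₁, h₂, Ideal.span_singleton_le_iff_mem, Submodule.mem_sup]
  obtain ⟨_, hx, _, hy, hxy⟩ := h
  obtain ⟨g, rfl⟩ := Ideal.mem_span_singleton.1 hx
  obtain ⟨c, rfl⟩ := Ideal.mem_span_singleton'.1 hy
  have hc : IsUnit c := H.isUnit_of_eq_mul_add (hnu ha₁) (hnu ha₂) hz u₁ u₂ (g := g) (by
    rw [← hxy, add_comm]; rfl)
  obtain ⟨d, hd⟩ := hc.exists_left_inv
  refine ⟨RamifiedWitt.teich E p i z * (-(d * g)), Ideal.mem_span_singleton.2 (dvd_mul_right _ _),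
    d * _, Ideal.mem_span_singleton'.2 ⟨d, rfl⟩, ?_⟩
  rw [← hxy]
  linear_combination (RamifiedWitt.ofWitt E p i (WittVector.teichmuller p a₂) +
    RamifiedWitt.ofBase E p i π * u₂) * hd

theorem distance_comm (hval : ∀ x y, val x ≤ val y ↔ y ∣ x) (hp : (p : E) ≠ 0)
    (hfrob : ∀ b : integers E, ∃ c : integers E, ‖(b - c ^ p : E)‖ < 1)
    (y₁ y₂ : ClassicalPoint E p i val) : distance y₁ y₂ = distance y₂ y₁ := by
  simp only [distance_eq]
  congr 1
  ext r
  exact exists_congr fun z => and_congr_left fun _ =>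
    ⟨ideal_le_comm hval hp hfrob, ideal_le_comm hval hp hfrob⟩

theorem ideal_le_of_distance_eq_zero (hval : ∀ x y, val x ≤ val y ↔ y ∣ x) (hp : (p : E) ≠ 0)
    (hfrob : ∀ b : integers E, ∃ c : integers E, ‖(b - c ^ p : E)‖ < 1)
    {y₁ y₂ : ClassicalPoint E p i val} (h : distance y₁ y₂ = 0) : y₁.ideal ≤ y₂.ideal := by
  obtain ⟨π, hπ⟩ := IsDiscreteValuationRing.exists_irreducible (integers E)
  obtain ⟨φ, H⟩ := RamifiedWitt.exists_isUniformized i hp hfrob hπ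
  obtain ⟨a, u, ha0, ha, h₂⟩ := y₂.exists_ideal_eq hπ
  have hval0 : ∀ x, val x = 0 → x = 0 := fun x hx => by
    rw [← zero_dvd_iff, ← hval, hx, map_zero]
  intro f hf
  rw [h₂]
  refine H.mem_span_of_forall_pow ?_ fun n => ?_
  · rwa [map_add, map_mul, H.map_witt, H.map_uniformizer, zero_mul, add_zero,
      WittVector.teichmuller_coeff_zero]
  -- The radius |aⁿ| is positive because a ≠ 0, so distance zero provides some z with |z| < |aⁿ|,
  -- that is, with aⁿ dividing z.
  · obtain ⟨z, hz, hzr⟩ := exists_of_distance_lt (r := (val (a ^ n) : ℝ)) (y₁ := y₁) (y₂ := y₂)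
      (by rw [h, NNReal.coe_pos, pos_iff_ne_zero]
          exact fun h0 => pow_ne_zero n ha0 (hval0 _ h0))
    have h3 : y₁.ideal ≤ Ideal.span {RamifiedWitt.teich E p i (a ^ n)} ⊔ y₂.ideal :=
      hz.trans (sup_le_sup_right (span_teich_le_of_dvd ((hval _ _).1 (by exact_mod_cast hzr.le))) _)
    rw [← h₂]
    refine (h3.trans (sup_le ?_ le_sup_right)) hf
    rw [Ideal.span_singleton_le_iff_mem, h₂, RamifiedWitt.teich, map_pow, map_pow]
    set T := RamifiedWitt.ofWitt E p i (WittVector.teichmuller p a)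
    set ϖ := RamifiedWitt.ofBase E p i π
    -- T + ϖu divides Tⁿ - (-ϖu)ⁿ, which turns powers of [a] into powers of π modulo the second
    -- ideal.
    obtain ⟨q, hq⟩ := sub_dvd_pow_sub_pow T (-(ϖ * u)) n
    rw [sub_neg_eq_add, sub_eq_iff_eq_add'] at hq
    rw [hq]
    refine Ideal.add_mem _ (Ideal.mem_sup_left (Ideal.mem_span_singleton.2 ?_))
      (Ideal.mem_sup_right (Ideal.mem_span_singleton.2 (dvd_mul_right _ _)))
    rw [neg_pow, mul_pow]
    exact (dvd_mul_right _ _).mul_left _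

theorem eq_of_distance_eq_zero (hval : ∀ x y, val x ≤ val y ↔ y ∣ x) (hp : (p : E) ≠ 0)
    (hfrob : ∀ b : integers E, ∃ c : integers E, ‖(b - c ^ p : E)‖ < 1)
    {y₁ y₂ : ClassicalPoint E p i val} (h : distance y₁ y₂ = 0) : y₁ = y₂ :=
  Subtype.ext (le_antisymm (ideal_le_of_distance_eq_zero hval hp hfrob h)
    (ideal_le_of_distance_eq_zero hval hp hfrob (by rwa [distance_comm hval hp hfrob])))

/-- The Fargues–Fontaine distance is an ultrametric that defines the topology of the curve. -/
@[reducible] noncomputable def metricSpace (hval : ∀ x y, val x ≤ val y ↔ y ∣ x)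
    (hp : (p : E) ≠ 0) (hfrob : ∀ b : integers E, ∃ c : integers E, ‖(b - c ^ p : E)‖ < 1) :
    MetricSpace (ClassicalPoint E p i val) :=
  -- This constructor keeps the topology already given, so later comparisons of topologies hold by
  -- `rfl`.
  MetricSpace.ofDistTopology distance distance_self (distance_comm hval hp hfrob)
    (fun x y z => (distance_le_max hval x y z).trans
      (max_le_add_of_nonneg (distance_nonneg x y) (distance_nonneg y z)))
    (fun _ => Iff.rfl) fun _ _ => eq_of_distance_eq_zero hval hp hfrob

end ClassicalPoint

end Metric

end FarguesFontaine

namespace FarguesFontaine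

/-! ### Divisibility and absolute value in 𝒪_F and in the tilt -/

section Integers

variable (F : Type w) [NormedField F] [IsUltrametricDist F]

theorem integersVal_le_iff (x y : integers F) :
    integersVal F x ≤ integersVal F y ↔ y ∣ x := by
  rw [← (Valuation.integer.integers (NormedField.valuation (K := F))).le_iff_dvd]
  rfl

instance (p : ℕ) [CharP F p] : CharP (integers F) p :=
  (Subring.subtype (integers F)).charP Subtype.val_injective p

instance (p : ℕ) [Fact p.Prime] [CharP F p] [IsAlgClosed F] : PerfectRing (integers F) p := by
  refine PerfectRing.ofSurjective _ _ fun x => ?_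
  obtain ⟨y, hy⟩ := IsAlgClosed.exists_pow_nat_eq (x : F) (Fact.out : p.Prime).pos
  have hy1 : ‖y‖ ≤ 1 := by
    rw [← pow_le_one_iff_of_nonneg (norm_nonneg y) (Fact.out : p.Prime).ne_zero, ← norm_pow, hy]
    exact x.2
  exact ⟨⟨y, hy1⟩, Subtype.ext hy⟩

end Integers

section Tilt

variable {K : Type u} [NormedField K] [IsUltrametricDist K] [CompleteSpace K]
  {p : ℕ} [Fact p.Prime] [Fact (‖(p : K)‖ < 1)]

/-- The compatible system of `p`-power roots in `𝒪_K` that represents an element of the tilt. -/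
noncomputable def preTiltRoots : PreTilt (integers K) p ≃* Perfection (integers K) p :=
  haveI : CharP (integers K ⧸ Ideal.span {(p : integers K)}) p :=
    inferInstanceAs (CharP (ModP (integers K) p) p)
  (Perfection.quotientMulEquiv p (Ideal.span {(p : integers K)})).symm

theorem mk_preTiltRoots (f : PreTilt (integers K) p) (n : ℕ) :
    Ideal.Quotient.mk (Ideal.span {(p : integers K)})
      (Perfection.coeffMonoidHom (integers K) p n (preTiltRoots f)) = PreTilt.coeff n f := by
  have : CharP (integers K ⧸ Ideal.span {(p : integers K)}) p :=
    inferInstanceAs (CharP (ModP (integers K) p) p)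
  exact congrArg (Perfection.coeff _ p n)
    ((Perfection.quotientMulEquiv p (Ideal.span {(p : integers K)})).apply_symm_apply f)

theorem coeff_preTiltRoots_pow (f : PreTilt (integers K) p) (n : ℕ) :
    Perfection.coeffMonoidHom (integers K) p n (preTiltRoots f) ^ p ^ n =
      Perfection.coeffMonoidHom (integers K) p 0 (preTiltRoots f) := by
  simp

/-- The equivalence is only multiplicative, so the image of zero is identified through its inverse.
-/
theorem preTiltRoots_zero (n : ℕ) :
    Perfection.coeffMonoidHom (integers K) p n (preTiltRoots (0 : PreTilt (integers K) p)) = 0 := by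
  have h : (preTiltRoots (0 : PreTilt (integers K) p)) =
      ⟨fun _ => 0, fun _ => zero_pow (Fact.out : p.Prime).ne_zero⟩ := by
    refine preTiltRoots.symm.injective (Perfection.ext fun m => ?_)
    rw [MulEquiv.symm_apply_apply]
    exact (map_zero (Ideal.Quotient.mk (Ideal.span {(p : integers K)}))).symm
  rw [h]
  rfl

theorem preTilt_val_eq (f : PreTilt (integers K) p) :
    PreTilt.val K NormedField.valuation (integers K) (Valuation.integer.integers _) p f =
      NormedField.valuation (Perfection.coeffMonoidHom (integers K) p 0 (preTiltRoots f) : K) := by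
  by_cases hf : f = 0
  · rw [hf, preTiltRoots_zero]
    simp
  obtain ⟨n, hn⟩ : ∃ n, PreTilt.coeff n f ≠ 0 := not_forall.1 fun h => hf (Perfection.ext h)
  refine (PreTilt.valAux_eq (Valuation.integer.integers _) hn).trans ?_
  rw [← mk_preTiltRoots] at hn ⊢
  refine (congrArg (· ^ p ^ n) (ModP.preVal_mk (Valuation.integer.integers _) hn)).trans ?_
  rw [← coeff_preTiltRoots_pow f n, Subring.coe_pow, map_pow]
  rfl

/-- Passing to compatible systems of p-power roots in 𝒪_K makes division possible: the quotients s n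
/ t n are again compatible, and integral because their powers are. -/
theorem preTilt_val_le_iff (f g : PreTilt (integers K) p) :
    PreTilt.val K NormedField.valuation (integers K) (Valuation.integer.integers _) p f ≤
      PreTilt.val K NormedField.valuation (integers K) (Valuation.integer.integers _) p g ↔
      g ∣ f := by
  have hp := (Fact.out : p.Prime).ne_zero
  constructor
  · intro h
    by_cases hg : g = 0
    · rw [hg, map_zero, nonpos_iff_eq_zero, PreTilt.map_eq_zero] at h
      rw [h]
      exact dvd_zero g
    rw [preTilt_val_eq, preTilt_val_eq] at h
    let s : ℕ → integers K := fun n => Perfection.coeffMonoidHom (integers K) p n (preTiltRoots f)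
    let t : ℕ → integers K := fun n => Perfection.coeffMonoidHom (integers K) p n (preTiltRoots g)
    have ht : ∀ n, (t n : K) ≠ 0 := fun n h0 => hg <| by
      rw [← PreTilt.map_eq_zero (Valuation.integer.integers NormedField.valuation),
        preTilt_val_eq, ← coeff_preTiltRoots_pow g n, Subring.coe_pow, map_pow]
      rw [show ((Perfection.coeffMonoidHom (integers K) p n (preTiltRoots g) : integers K) : K) = 0 from h0,
        map_zero, zero_pow (pow_ne_zero n hp)]
    have hst : ∀ n, ‖(s n : K)‖ ≤ ‖(t n : K)‖ := fun n => by
      rw [← pow_le_pow_iff_left₀ (norm_nonneg _) (norm_nonneg _) (pow_ne_zero n hp), ← norm_pow,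
        ← norm_pow, ← Subring.coe_pow, ← Subring.coe_pow, coeff_preTiltRoots_pow,
        coeff_preTiltRoots_pow]
      exact h
    let q : ℕ → integers K := fun n => ⟨s n / t n, by
      rw [mem_integers, norm_div]
      exact div_le_one_of_le₀ (hst n) (norm_nonneg _)⟩
    let x : Perfection (integers K) p := ⟨q, fun n => Subtype.ext <| by
      change (s (n + 1) / t (n + 1) : K) ^ p = s n / t n
      rw [div_pow, ← Subring.coe_pow, ← Subring.coe_pow]
      congr 2 <;> exact Perfection.coeffMonoidHom_pow_p' _ _⟩
    refine ⟨preTiltRoots.symm x, preTiltRoots.injective ?_⟩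
    rw [map_mul, MulEquiv.apply_symm_apply]
    refine Perfection.extMonoid fun n => Subtype.ext ?_
    change (s n : K) = t n * (s n / t n)
    rw [mul_div_cancel₀ _ (ht n)]
  · rintro ⟨c, rfl⟩
    rw [map_mul]
    refine mul_le_of_le_one_right' ?_
    rw [preTilt_val_eq]
    exact (Perfection.coeffMonoidHom (integers K) p 0 (preTiltRoots c)).2

end Tilt

end FarguesFontaine

/-! ### Completions of a number field: discrete valuation and perfect residue field -/

namespace Arithmeticoid
open FarguesFontaine

variable {L : Type u} [Field L] [NumberField L] (v : HeightOneSpectrum (𝓞 L))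

theorem mem_integers_localField_iff (x : LocalField v) :
    x ∈ integers (LocalField v) ↔ x ∈ v.adicCompletionIntegers L :=
  Valued.toNormedField.norm_le_one_iff (L := v.adicCompletion L) (Γ₀ := WithZero (Multiplicative ℤ))

instance : IsDiscreteValuationRing (integers (LocalField v)) := by
  let e : v.adicCompletionIntegers L ≃+* integers (LocalField v) :=
    { toFun := fun x => ⟨x.1, (mem_integers_localField_iff v _).2 x.2⟩
      invFun := fun x => ⟨x.1, (mem_integers_localField_iff v _).1 x.2⟩
      left_inv := fun _ => rfl
      right_inv := fun _ => rfl
      map_mul' := fun _ _ => rfl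
      map_add' := fun _ _ => rfl }
  exact IsDiscreteValuationRing.RingEquivClass.isDiscreteValuationRing e

theorem residueChar_ne_zero : (residueChar v : LocalField v) ≠ 0 := by
  have : CharZero (v.adicCompletion L) :=
    charZero_of_injective_algebraMap (FaithfulSMul.algebraMap_injective L _)
  exact Nat.cast_ne_zero (R := v.adicCompletion L).2 (Fact.out : (residueChar v).Prime).ne_zero

theorem exists_sub_pow_mem (r : 𝓞 L) : ∃ s : 𝓞 L, r - s ^ residueChar v ∈ v.asIdeal := by
  have : CharP (𝓞 L ⧸ v.asIdeal) (residueChar v) := ringChar.charP _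
  obtain ⟨y, hy⟩ := surjective_frobenius (𝓞 L ⧸ v.asIdeal) (residueChar v) (Ideal.Quotient.mk _ r)
  obtain ⟨s, rfl⟩ := Ideal.Quotient.mk_surjective y
  exact ⟨s, by rw [← Ideal.Quotient.eq, ← hy, map_pow, frobenius_def]⟩

theorem exists_norm_sub_algebraMap_lt_one {x : v.adicCompletion L} (hx : ‖x‖ ≤ 1) :
    ∃ r : 𝓞 L, ‖x - FinitePlace.embedding v (algebraMap (𝓞 L) L r)‖ < 1 := by
  obtain ⟨l, hl⟩ := (v.denseRange_algebraMap L).exists_dist_lt x one_pos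
  rw [dist_eq_norm] at hl
  -- The approximation l is v-integral by the ultrametric inequality, since x is and ‖x - l‖ < 1.
  have hl1 : v.valuation L l ≤ 1 := by
    rw [← HeightOneSpectrum.adicCompletion.valued_coe, ← Valued.toNormedField.norm_le_one_iff]
    have h := (IsUltrametricDist.norm_add_le_max x (-(x - algebraMap L _ l))).trans
      (max_le hx ((norm_neg _).trans_le hl.le))
    rwa [← sub_eq_add_neg, sub_sub_cancel] at h
  obtain ⟨r, hr⟩ := v.exists_valuation_sub_lt_of_integer hl1 1
  rw [Units.val_one, ← HeightOneSpectrum.adicCompletion.valued_coe,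
    ← Valued.toNormedField.norm_lt_one_iff] at hr
  refine ⟨r, ?_⟩
  have h : ‖FinitePlace.embedding v (algebraMap (𝓞 L) L r - l)‖ < 1 := hr
  have hl' : ‖x - FinitePlace.embedding v l‖ < 1 := hl
  have h2 := (IsUltrametricDist.norm_add_le_max _ _).trans_lt (max_lt hl' ((norm_neg _).trans_lt h))
  rwa [map_sub, neg_sub, sub_add_sub_cancel] at h2

/-- Perfectness of the residue field: b is approximated by an algebraic integer, and Frobenius is
surjective on the finite field 𝓞 L / v. -/
theorem exists_norm_sub_pow_lt_one (b : integers (LocalField v)) :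
    ∃ c : integers (LocalField v), ‖(b - c ^ residueChar v : LocalField v)‖ < 1 := by
  let b' : v.adicCompletion L := b.1
  obtain ⟨r, hr⟩ := exists_norm_sub_algebraMap_lt_one v (x := b') b.2
  obtain ⟨s, hs⟩ := exists_sub_pow_mem v r
  rw [← FinitePlace.norm_lt_one_iff_mem L v] at hs
  let c : v.adicCompletion L := FinitePlace.embedding v (algebraMap (𝓞 L) L s)
  refine ⟨⟨c, FinitePlace.norm_le_one L v s⟩, ?_⟩
  have : ‖b' - c ^ residueChar v‖ < 1 := by
    have h := (IsUltrametricDist.norm_add_le_max _ _).trans_lt (max_lt hr hs)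
    rwa [map_sub, map_sub, map_pow, map_pow, sub_add_sub_cancel] at h
  exact this

end Arithmeticoid

/-! ### Countability of places and metrics on countable products -/

section Product

theorem countable_ideal (R : Type*) [CommRing R] [IsNoetherianRing R] [Countable R] :
    Countable (Ideal R) := by
  have : Function.Surjective (fun s : Finset R => Ideal.span (s : Set R)) := fun I =>
    (IsNoetherian.noetherian I).imp fun _ h => h
  exact this.countable

theorem IsDedekindDomain.HeightOneSpectrum.countable (R : Type*) [CommRing R] [IsNoetherianRing R]
    [Countable R] : Countable (HeightOneSpectrum R) :=
  have := countable_ideal R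
  Function.Injective.countable (f := HeightOneSpectrum.asIdeal) fun _ _ => HeightOneSpectrum.ext

theorem NumberField.RingOfIntegers.countable (L : Type*) [Field L] [NumberField L] :
    Countable (𝓞 L) :=
  (RingOfIntegers.basis L).equivFun.injective.countable

/-- The sum of the distances is a distance on a product that defines the product topology. -/
@[reducible] def prodSumMetricSpace (M N : Type*) [MetricSpace M] [MetricSpace N] :
    MetricSpace (M × N) :=
  MetricSpace.ofDistTopology (fun x y => dist x.1 y.1 + dist x.2 y.2) (fun x => by simp)
    (fun x y => by rw [dist_comm x.1, dist_comm x.2])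
    (fun x y z => by linarith [dist_triangle x.1 y.1 z.1, dist_triangle x.2 y.2 z.2])
    (fun s => by
      rw [Metric.isOpen_iff]
      refine forall₂_congr fun x _ => ⟨?_, ?_⟩
      · rintro ⟨ε, hε, h⟩
        refine ⟨ε, hε, fun y hy => h ?_⟩
        rw [Metric.mem_ball, dist_comm, Prod.dist_eq]
        exact (max_le_add_of_nonneg dist_nonneg dist_nonneg).trans_lt hy
      · rintro ⟨ε, hε, h⟩
        refine ⟨ε / 2, half_pos hε, fun y hy => h y ?_⟩
        rw [Metric.mem_ball, dist_comm, Prod.dist_eq, max_lt_iff] at hy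
        linarith [hy.1, hy.2])
    (fun x y h => by
      have h1 := dist_nonneg (x := x.1) (y := y.1)
      have h2 := dist_nonneg (x := x.2) (y := y.2)
      exact Prod.ext (dist_le_zero.1 (by linarith)) (dist_le_zero.1 (by linarith)))

/-- An injective map to `ℕ` as an encoding. -/
@[reducible] noncomputable def encodableOfInjective {α : Type*} {e : α → ℕ}
    (he : Function.Injective e) : Encodable α := by
  classical
  exact ⟨e, fun n => if h : ∃ x, e x = n then some h.choose else none, fun x => by
    have h : ∃ y, e y = e x := ⟨x, rfl⟩
    rw [dif_pos h, he h.choose_spec]⟩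

/-- The distance on a countable product of metric spaces given by an injective weight function on
the index set. -/
theorem exists_metricSpace_pi {α : Type*} {X : α → Type*} [∀ a, MetricSpace (X a)] {e : α → ℕ}
    (he : Function.Injective e) :
    ∃ m : MetricSpace (∀ a, X a),
      (∀ y z, m.dist y z = ∑' a, min ((1 / 2 : ℝ) ^ e a) (dist (y a) (z a))) ∧
      m.toPseudoMetricSpace.toUniformSpace.toTopologicalSpace = Pi.topologicalSpace := by
  -- `PiCountable` weights each coordinate by its code, which under this encoding is e a by
  -- definition.
  let := encodableOfInjective he
  refine ⟨PiCountable.metricSpace, fun y z => ?_, rfl⟩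
  rw [one_div]
  rfl

/-- The distance on a product of two countable families of metric spaces given by an injective
weight function on the index set. -/
theorem exists_metricSpace_prod_pi {α β : Type*} [Fintype β] {X : α → Type*} {Y : β → Type*}
    [∀ a, MetricSpace (X a)] [∀ b, MetricSpace (Y b)] {e : α ⊕ β → ℕ}
    (he : Function.Injective e) :
    ∃ m : MetricSpace ((∀ a, X a) × (∀ b, Y b)),
      (∀ y z, m.dist y z = (∑' a, min ((1 / 2 : ℝ) ^ e (Sum.inl a)) (dist (y.1 a) (z.1 a))) +
        ∑ b, min ((1 / 2 : ℝ) ^ e (Sum.inr b)) (dist (y.2 b) (z.2 b))) ∧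
      m.toPseudoMetricSpace.toUniformSpace.toTopologicalSpace = instTopologicalSpaceProd := by
  obtain ⟨m₁, h₁, t₁⟩ := exists_metricSpace_pi (X := X) (he.comp Sum.inl_injective)
  obtain ⟨m₂, h₂, t₂⟩ := exists_metricSpace_pi (X := Y) (he.comp Sum.inr_injective)
  refine ⟨@prodSumMetricSpace _ _ m₁ m₂, fun y z => ?_, ?_⟩
  · rw [← tsum_fintype (L := .unconditional β)]
    exact congrArg₂ (· + ·) (h₁ y.1 z.1) (h₂ y.2 z.2)
  · rw [← t₁, ← t₂]
    rfl

theorem metrizableSpace_prod_pi {α β : Type*} [Countable α] [Fintype β] {X : α → Type*}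
    {Y : β → Type*} [∀ a, MetricSpace (X a)] [∀ b, MetricSpace (Y b)] :
    TopologicalSpace.MetrizableSpace ((∀ a, X a) × (∀ b, Y b)) := by
  obtain ⟨e, he⟩ := Countable.exists_injective_nat (α ⊕ β)
  obtain ⟨m, -, hm⟩ := exists_metricSpace_prod_pi (X := X) (Y := Y) he
  have : @TopologicalSpace.MetrizableSpace _
      m.toPseudoMetricSpace.toUniformSpace.toTopologicalSpace := inferInstance
  rwa [hm] at this

end Product

/-! ### Assembly over all places -/

namespace Arithmeticoid

open FarguesFontaine

variable {L : Type u} [Field L] [NumberField L]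

instance : Countable (HeightOneSpectrum (𝓞 L)) :=
  have := NumberField.RingOfIntegers.countable L
  HeightOneSpectrum.countable _

variable (v : HeightOneSpectrum (𝓞 L))

instance : IsDomain (TiltIntegers (LocalField v) (residueChar v)) :=
  PreTilt.isDomain (CompletedAlgCl (LocalField v)) NormedField.valuation _
    (Valuation.integer.integers _) _

/-- The Fargues–Fontaine distance on the factor at a finite place. -/
@[reducible] noncomputable def localCurveMetricSpace : MetricSpace (LocalCurve v) :=
  ClassicalPoint.metricSpace preTilt_val_le_iff (residueChar_ne_zero v)
    (exists_norm_sub_pow_lt_one v)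

/-- The Fargues–Fontaine distance on the factor at a finite place, for an arbitrary algebraically
closed perfectoid field. -/
@[reducible] noncomputable def curveMetricSpace (F : Type w) [NormedField F] [IsUltrametricDist F]
    [IsAlgClosed F] [CharP F (residueChar v)]
    (i : PreTilt (integers (LocalField v)) (residueChar v) →+* integers F) :
    MetricSpace (Curve (LocalField v) (residueChar v) F i) :=
  ClassicalPoint.metricSpace (integersVal_le_iff F) (residueChar_ne_zero v)
    (exists_norm_sub_pow_lt_one v)

end Arithmeticoid

theorem mainTheorem3 (L : Type u) [Field L] [NumberField L] (_hL : IsEmpty (L →+* ℝ)) :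
    -- the set of places is countable
    Countable (Arithmeticoid.Place L) ∧
    -- every factor is metrisable; at a finite place, by the distance of the curve
    (∀ v : HeightOneSpectrum (𝓞 L), ∃ m : MetricSpace (Arithmeticoid.LocalCurve v),
      (∀ y z, m.dist y z = y.distance z) ∧
      m.toPseudoMetricSpace.toUniformSpace.toTopologicalSpace =
        (inferInstance : TopologicalSpace (Arithmeticoid.LocalCurve v))) ∧
    TopologicalSpace.MetrizableSpace (Set.Ioi (0 : ℝ)) ∧
    -- the space of arithmeticoids is metrisable
    TopologicalSpace.MetrizableSpace (Arithmeticoid.AdelicCurve L) ∧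
    -- and the standard distance on the countable product is a distance between arithmeticoids
    -- which defines its topology
    (∀ e : Arithmeticoid.Place L → ℕ, Function.Injective e →
      ∃ m : MetricSpace (Arithmeticoid.AdelicCurve L),
        (∀ y z, m.dist y z = Arithmeticoid.distance e y z) ∧
        m.toPseudoMetricSpace.toUniformSpace.toTopologicalSpace =
          (inferInstance : TopologicalSpace (Arithmeticoid.AdelicCurve L))) ∧
    -- metrisability for other families of algebraically closed perfectoid fields
    (∀ (F : HeightOneSpectrum (𝓞 L) → Type w)
      [∀ v, NontriviallyNormedField (F v)] [∀ v, IsUltrametricDist (F v)]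
      [∀ v, CompleteSpace (F v)] [∀ v, IsAlgClosed (F v)]
      [∀ v, CharP (F v) (Arithmeticoid.residueChar v)]
      (i : (v : HeightOneSpectrum (𝓞 L)) →
        PreTilt (FarguesFontaine.integers (Arithmeticoid.LocalField v)) (Arithmeticoid.residueChar v) →+*
          FarguesFontaine.integers (F v)),
      TopologicalSpace.MetrizableSpace (Arithmeticoid.AdelicCurveOf F i)) := by
  refine ⟨inferInstance, fun v => ⟨Arithmeticoid.localCurveMetricSpace v, fun _ _ => rfl, rfl⟩,
    inferInstance, ?_, fun e he => ?_, ?_⟩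
  -- The installed metrics induce definitionally the given topologies of the factors, so the product
  -- topology is the intended one.
  · let := fun v : HeightOneSpectrum (𝓞 L) => Arithmeticoid.localCurveMetricSpace v
    exact metrizableSpace_prod_pi
  · let := fun v : HeightOneSpectrum (𝓞 L) => Arithmeticoid.localCurveMetricSpace v
    exact exists_metricSpace_prod_pi he
  · intro F _ _ _ _ _ i
    let := fun v : HeightOneSpectrum (𝓞 L) => Arithmeticoid.curveMetricSpace v (F v) (i v)
    exact metrizableSpace_prod_pi
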